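/- **Setting.** Let $\Omega=[a,b]$, $p\ge 1$, and impose at each end of $\Omega$ a Dirichlet or a Neumann condition, at least one of them Dirichlet; $n_\gamma=\mp1$ is the outward normal at a left/right end. Let $\lambda>0$ on $\Omega$ and let $U,\psi$ solve $$-(\lambda U')'=F,\quad U|_{\Gamma^D}=u_D,\quad n_\gamma\lambda U'|_{\Gamma^N}=u_N,\qquad -(\lambda \psi')'=G,\quad \psi|_{\Gamma^D}=\psi_D,\quad n_\gamma\lambda\psi'|_{\Gamma^N}=\psi_N ,$$ with $U,\psi\in C^{2p+2}(\Omega)$, $\lambda\in C^{2p+1}(\Omega)$, $F,G\in C^{2p}(\Omega)$. Put $$I(U)=\int_\Omega GU\,dx-\psi_D[n_\gamma\lambda U']_{\Gamma^D}+\psi_N U|_{\Gamma^N},\qquad I(\psi)=\int_\Omega \psi F\,dx-u_D[n_\gamma\lambda \psi']_{\Gamma^D}+u_N\psi|_{\Gamma^N}$$ (boundary terms summed over the ends concerned). **Operators.** Tessellate $\Omega$ by elements $\Omega_k$ with $n$ nodes each, all in $\Omega$; $h_k$ is the largest distance between two nodes of $\Omega_k$ and $h=\max_k h_k$. Each element carries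 a diagonal positive definite $H$, row vectors $R_\ell,R_r$ that extrapolate polynomials of degree $\le p$ exactly to its ends, $E=R_r^TR_r-R_\ell^TR_\ell$, and $D=H^{-1}(S+\frac12E)$, $S^T=-S$, exact for the derivative on degree $\le p$. With $\Lambda=\mathrm{diag}(\lambda(x_i))$ the second-derivative operator is $D^{(2)}=H^{-1}(-M+E\Lambda D_b)$, $M=\sum_i\lambda(x_i)\bar M_i$, and is either (narrow stencil, degree $p+1$) with $\bar M_i$ symmetric positive semidefinite, $D^{(2)}(\lambda)P=(\lambda P')'$ at the nodes for all polynomials $\lambda,P$ with $\deg(\lambda P)\le p+1$, and $D_b$ exact for the derivative on degree $\le p+1$ (in the rows seen by $R_\ell$ or $R_r$); or (wide stencil, degree $p$) $D^{(2)}=D\Lambda D$, i.e. $D_b=D$, $M=D^TH\Lambda D$. Put $D_\gamma=n_\gamma R_\gamma\Lambda D_b$. **Discretizations.** The discrete primal problem is $D^{(2)}_ku_{h,k}+f_k-H_k^{-1}s_k(u_h)=0$ for all $k$, where $s_k$ is the sum of $$R_{\gamma k}^T\big(T^{(1)}_{\gamma k}j+T^{(3)}_{\gamma k}q\big)+D_{\gamma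 k}^T\big(T^{(2)}_{\gamma k}j+T^{(4)}_{\gamma k}q\big),\quad j=R_{\gamma k}u_{h,k}-R_{\gamma v}u_{h,v},\ q=D_{\gamma k}u_{h,k}+D_{\gamma v}u_{h,v},$$ over the interfaces $\gamma$ of $\Omega_k$ with neighbours $\Omega_v$, of $(T^{(D)}_\gamma R_{\gamma k}^T-D_{\gamma k}^T)(R_{\gamma k}u_{h,k}-u_D)$ at a Dirichlet end and of $R_{\gamma k}^T(D_{\gamma k}u_{h,k}-u_N)$ at a Neumann end. The discrete adjoint problem is $D^{(2)}_k\psi_{h,k}+g_k+H_k^{-1}(M_k-M_k^T)\psi_{h,k}-H_k^{-1}s_k^*(\psi_h)=0$, where $s_k^*$ has the same boundary terms with $\psi_D,\psi_N$ and the interface terms $$R_{\gamma k}^T\big(T^{(1)}_{\gamma k}R_{\gamma k}\psi_{h,k}-T^{(1)}_{\gamma v}R_{\gamma v}\psi_{h,v}+(T^{(2)}_{\gamma k}+1)D_{\gamma k}\psi_{h,k}-T^{(2)}_{\gamma v}D_{\gamma v}\psi_{h,v}\big)+D_{\gamma k}^T\big((T^{(3)}_{\gamma k}-1)R_{\gamma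 k}\psi_{h,k}+T^{(3)}_{\gamma v}R_{\gamma v}\psi_{h,v}+T^{(4)}_{\gamma k}D_{\gamma k}\psi_{h,k}+T^{(4)}_{\gamma v}D_{\gamma v}\psi_{h,v}\big).$$ Here $f,g,u,\psi$ as vectors denote restrictions of $F,G,U,\psi$ to the nodes. The discrete functionals are $$I_h(u_h)=\sum_k g_k^TH_ku_{h,k}+\sum_{\gamma\in\Gamma^D}\big(-\psi_DD_\gamma u_h+\psi_DT^{(D)}_\gamma(R_\gamma u_h-u_D)\big)+\sum_{\gamma\in\Gamma^N}\psi_NR_\gamma u_h,$$ and $I_h(\psi_h)$, obtained by exchanging $g,\psi_D,\psi_N,u_h,u_D$ for $f,u_D,u_N,\psi_h,\psi_D$. **Assumptions on the discretizations.** (i) Scaling with a constant $C$: entries of $R_\gamma$ are bounded by $C$; $H\le Ch_k$; entries of $D,D_b,\bar M_i$ are at most $C/h_k$; at interfaces $|T^{(1)}|\le C/h_k$, $|T^{(2)}|,|T^{(3)}|\le C$, $|T^{(4)}|\le Ch_k$; at Dirichlet ends $|T^{(D)}|\le C/h_k$; $h_k\le C|\Omega_k|$ and $h_k\le Ch_v$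 for neighbours. (ii) Adjoint consistency: at every interface $T^{(1)}_{\gamma k}=T^{(1)}_{\gamma v}$, $T^{(2)}_{\gamma k}+1=-T^{(2)}_{\gamma v}$, $T^{(3)}_{\gamma k}-1=-T^{(3)}_{\gamma v}$, $T^{(4)}_{\gamma k}=T^{(4)}_{\gamma v}$, and $M_k=M_k^T$. (iii) $u_h,\psi_h$ solve the discrete primal and adjoint problems and $\|u-u_h\|_\infty\le Ch^{p+1}$, $\|\psi-\psi_h\|_\infty\le Ch^{p+1}$. **Theorem.** $I(U)=I(\psi)$, and for every $C$ there is a constant $K$, depending only on $p$, $n$, $C$ and the continuous problem, such that for every such discretization $$|I(U)-I_h(u_h)|\le K h^{2p},\qquad |I(\psi)-I_h(\psi_h)|\le K h^{2p}.$$ -/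

import Mathlib

open Set Matrix Polynomial

noncomputable section

/-- The two ends of an interval (a subdomain or the whole domain). -/
inductive Side
  | left
  | right
  deriving DecidableEq

instance : Fintype Side := ⟨{Side.left, Side.right}, fun γ => by cases γ <;> simp⟩

namespace Side

/-- The opposite end. -/
def opp : Side → Side
  | left => right
  | right => left

/-- The outward unit normal: `-1` at the left end, `1` at the right end. -/
def normal : Side → ℝ
  | left => -1
  | right => 1

end Side

/-- The type of boundary condition imposed at an end of the domain. -/
inductive BC
  | dirichlet
  | neumann
  deriving DecidableEq

/-! ### The continuous problem on `Ω = [a, b]` -/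

/-- The end points of `[a, b]`. -/
def domainEnd (a b : ℝ) : Side → ℝ
  | Side.left => a
  | Side.right => b

/-- The flux `λ dV/dx` on `[a, b]` (one-sided derivatives at the end points). -/
def flux (a b : ℝ) (lam V : ℝ → ℝ) (x : ℝ) : ℝ :=
  lam x * derivWithin V (Icc a b) x

/-- The normal flux `n_γ λ dV/dx` at an end of the domain. -/
def normalFlux (a b : ℝ) (lam V : ℝ → ℝ) (γ : Side) : ℝ :=
  γ.normal * flux a b lam V (domainEnd a b γ)

/-- The steady diffusion problem `-(λ V')' = S` on `[a, b]`, with `V = data γ` at a Dirichlet end `γ`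
and `n_γ λ V' = data γ` at a Neumann end `γ`. The primal problem is the case `V = U`, `S = F`,
the adjoint problem the case `V = ψ`, `S = G`. -/
structure SolvesDiffusion (a b : ℝ) (bc : Side → BC) (lam S V : ℝ → ℝ) (data : Side → ℝ) :
    Prop where
  pde : ∀ x ∈ Icc a b, -derivWithin (flux a b lam V) (Icc a b) x = S x
  dirichlet : ∀ γ, bc γ = BC.dirichlet → V (domainEnd a b γ) = data γ
  neumann : ∀ γ, bc γ = BC.neumann → normalFlux a b lam V γ = data γ

/-- The linear functional
`∫ W V dx - ∑_{Dirichlet ends} data γ (n_γ λ V')(γ) + ∑_{Neumann ends} data γ V(γ)`.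
`I(U)` is the case `W = G`, `data = (ψ_D, ψ_N)`, and `I(ψ)` the case `W = F`,
`data = (u_D, u_N)`. -/
def functional (a b : ℝ) (bc : Side → BC) (lam W : ℝ → ℝ) (data : Side → ℝ) (V : ℝ → ℝ) : ℝ :=
  (∫ x in a..b, W x * V x) +
    ∑ γ : Side, match bc γ with
      | BC.dirichlet => -(data γ * normalFlux a b lam V γ)
      | BC.neumann => data γ * V (domainEnd a b γ)

/-! ### Generalized SBP operators on one element -/

/-- The data of diagonal-norm first- and second-derivative operators on an element with `n` nodes.
The laws they have to satisfy are `IsSBP`, `IsNarrow` and `IsWide` below. -/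
structure SBPElement (n : ℕ) where
  /-- the end points of the element -/
  bdry : Side → ℝ
  /-- the nodes -/
  node : Fin n → ℝ
  /-- the diagonal of the norm matrix `H` -/
  w : Fin n → ℝ
  /-- the first-derivative operator `D` -/
  D : Matrix (Fin n) (Fin n) ℝ
  /-- the extrapolation row vectors `R_γ` -/
  R : Side → Fin n → ℝ
  /-- the matrix `D_b` -/
  Db : Matrix (Fin n) (Fin n) ℝ
  /-- the matrices `M̄_i` of the decomposition `M = ∑ i, λ(x_i) M̄_i` -/
  Mbar : Fin n → Matrix (Fin n) (Fin n) ℝ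

namespace SBPElement

variable {n : ℕ} (E : SBPElement n)

/-- Restriction of a function to the nodes. -/
def restrict (f : ℝ → ℝ) : Fin n → ℝ := fun i => f (E.node i)

/-- The size of the element: the largest distance between two of its nodes. -/
def size : ℝ := Metric.diam (Set.range E.node)

/-- The norm matrix. -/
def H : Matrix (Fin n) (Fin n) ℝ := Matrix.diagonal E.w

/-- `E = R_rᵀ R_r - R_ℓᵀ R_ℓ`. -/
def Emat : Matrix (Fin n) (Fin n) ℝ :=
  ∑ γ : Side, γ.normal • Matrix.vecMulVec (E.R γ) (E.R γ)

/-- `Λ = diag(λ(x_1), …, λ(x_n))`. -/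
def Lam (lam : ℝ → ℝ) : Matrix (Fin n) (Fin n) ℝ := Matrix.diagonal (E.restrict lam)

/-- `M = ∑ i, λ(x_i) M̄_i`. -/
def M (lam : ℝ → ℝ) : Matrix (Fin n) (Fin n) ℝ := ∑ i, lam (E.node i) • E.Mbar i

/-- The second-derivative operator `D⁽²⁾(λ) = H⁻¹ (-M + E Λ D_b)`. -/
def D2 (lam : ℝ → ℝ) : Matrix (Fin n) (Fin n) ℝ :=
  (E.H)⁻¹ * (-(E.M lam) + E.Emat * E.Lam lam * E.Db)

/-- The row vector `D_γ = n_γ R_γ Λ D_b`. -/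
def Dn (lam : ℝ → ℝ) (γ : Side) : Fin n → ℝ :=
  γ.normal • (E.R γ ᵥ* (E.Lam lam * E.Db))

/-- `D` is a degree `p` diagonal-norm generalized SBP operator on the element. The nodes need not be
uniform, nor include the end points, nor lie in the element. Exactness of `R_γ` for a degree
`τ ≥ p` is the same as exactness for degree `p`, in its weakest case. -/
structure IsSBP (p : ℕ) : Prop where
  bdry_lt : E.bdry Side.left < E.bdry Side.right
  node_injective : Function.Injective E.node
  w_pos : ∀ i, 0 < E.w i
  accurate : ∀ P : ℝ[X], P.natDegree ≤ p →
    E.D *ᵥ E.restrict (fun x => P.eval x) = E.restrict (fun x => P.derivative.eval x)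
  decomposition : ∃ S : Matrix (Fin n) (Fin n) ℝ, Sᵀ = -S ∧
    E.D = (E.H)⁻¹ * (S + (1 / 2 : ℝ) • E.Emat)
  extrapolation : ∀ γ, ∀ P : ℝ[X], P.natDegree ≤ p →
    E.R γ ⬝ᵥ E.restrict (fun x => P.eval x) = P.eval (E.bdry γ)

/-- `D⁽²⁾` is a narrow-stencil second-derivative operator of degree `p + 1`, order-matched with the
degree `p` operator `D` (it uses the same `H`, `R_γ` and nodes). Only those rows of `D_b` enter the
operator, and are asked to approximate the derivative, that are seen by an extrapolation vector. -/
structure IsNarrow (p : ℕ) : Prop where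
  accurate : ∀ lam P : ℝ[X], (lam * P).natDegree ≤ p + 1 →
    E.D2 (fun x => lam.eval x) *ᵥ E.restrict (fun x => P.eval x) =
      E.restrict (fun x => (lam * P.derivative).derivative.eval x)
  posSemidef : ∀ i, (E.Mbar i).PosSemidef
  Db_accurate : ∀ P : ℝ[X], P.natDegree ≤ p + 1 → ∀ i, (∃ γ, E.R γ i ≠ 0) →
    (E.Db *ᵥ E.restrict (fun x => P.eval x)) i = P.derivative.eval (E.node i)

/-- The second-derivative operator is the wide-stencil one: `D_b = D` and `M = Dᵀ H Λ D`, so that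
`D⁽²⁾ = D Λ D` (see `D2_eq_of_isWide`). -/
structure IsWide : Prop where
  Db_eq : E.Db = E.D
  Mbar_eq : ∀ i, E.Mbar i = E.w i • Matrix.vecMulVec (E.D i) (E.D i)

theorem M_eq_of_isWide (hw : E.IsWide) (lam : ℝ → ℝ) :
    E.M lam = E.Dᵀ * E.H * E.Lam lam * E.D := by
  ext i j
  simp only [M, hw.Mbar_eq, H, Lam, Matrix.sum_apply, Matrix.smul_apply, Matrix.vecMulVec_apply,
    smul_eq_mul, Matrix.mul_assoc, Matrix.mul_apply (M := E.Dᵀ), Matrix.diagonal_mul,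
    Matrix.transpose_apply, restrict]
  exact Finset.sum_congr rfl fun k _ => by ring

theorem D2_eq_of_isWide {p : ℕ} (hE : E.IsSBP p) (hw : E.IsWide) (lam : ℝ → ℝ) :
    E.D2 lam = E.D * E.Lam lam * E.D := by
  obtain ⟨S, hS, hD⟩ := hE.decomposition
  have hdet : IsUnit E.H.det := by
    rw [H, Matrix.det_diagonal]
    exact (Finset.prod_ne_zero_iff.mpr fun i _ => (hE.w_pos i).ne').isUnit
  have hHt : (E.H)ᵀ = E.H := Matrix.diagonal_transpose _
  have hEt : (E.Emat)ᵀ = E.Emat := by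
    simp [Emat, Matrix.transpose_sum, Matrix.transpose_vecMulVec]
  have hHD : E.H * E.D = S + (1 / 2 : ℝ) • E.Emat := by
    rw [hD, Matrix.mul_nonsing_inv_cancel_left _ _ hdet]
  have hDH : E.Dᵀ * E.H = -S + (1 / 2 : ℝ) • E.Emat := by
    have := congrArg Matrix.transpose hHD
    rwa [Matrix.transpose_mul, hHt, Matrix.transpose_add, hS, Matrix.transpose_smul, hEt] at this
  have hsum : E.Emat = E.H * E.D + E.Dᵀ * E.H := by
    rw [hHD, hDH]
    module
  have key : -(E.Dᵀ * E.H * E.Lam lam * E.D) + E.Emat * E.Lam lam * E.D =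
      E.H * (E.D * E.Lam lam * E.D) := by
    rw [hsum]
    noncomm_ring
  rw [D2, M_eq_of_isWide E hw, hw.Db_eq, key, Matrix.nonsing_inv_mul_cancel_left _ _ hdet]

end SBPElement

/-! ### The SBP-SAT discretization -/

/-- A chain of `ne` elements with `n` nodes each, with the SAT coefficients: `T1 γ k`, …, `T4 γ k`
belong to the interface `γ` of element `k`, and `TD γ` to the end `γ` of the domain. -/
structure Discretization (n : ℕ) where
  ne : ℕ
  elem : Fin ne → SBPElement n
  T1 : Side → Fin ne → ℝ
  T2 : Side → Fin ne → ℝ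
  T3 : Side → Fin ne → ℝ
  T4 : Side → Fin ne → ℝ
  TD : Side → ℝ

namespace Discretization

variable {n : ℕ} (d : Discretization n)

/-- The element on the other side of the end `γ` of element `k`, if that end is not an end of the
domain. -/
def nbr (γ : Side) (k : Fin d.ne) : Option (Fin d.ne) :=
  match γ with
  | Side.left =>
      if 0 < (k : ℕ) then some ⟨(k : ℕ) - 1, lt_of_le_of_lt (Nat.sub_le _ _) k.isLt⟩ else none
  | Side.right => if h : (k : ℕ) + 1 < d.ne then some ⟨(k : ℕ) + 1, h⟩ else none

/-- The elements are numbered from left to right and tessellate `[a, b]`; all nodes lie in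
`[a, b]`, so that functions on `[a, b]` can be restricted to them. -/
structure Tessellates (a b : ℝ) : Prop where
  ne_pos : 0 < d.ne
  interior : ∀ γ k v, d.nbr γ k = some v → (d.elem k).bdry γ = (d.elem v).bdry γ.opp
  boundary : ∀ γ k, d.nbr γ k = none → (d.elem k).bdry γ = domainEnd a b γ
  node_mem : ∀ k i, (d.elem k).node i ∈ Icc a b

/-- The mesh size `h`: the largest element size. -/
def h : ℝ := ⨆ k, (d.elem k).size

/-- The operators scale as if they were mapped affinely from a reference
element, and the SAT coefficients have the usual magnitude: `R_γ = O(1)`, `H = O(h)`,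
`D, D_b, M̄_i = O(h⁻¹)`, `T⁽¹⁾, T⁽ᴰ⁾ = O(h⁻¹)`, `T⁽²⁾, T⁽³⁾ = O(1)`, `T⁽⁴⁾ = O(h)`, all with
the constant `C`; elements are comparable in size with the distance of their end points and with
their neighbours. -/
structure Scaled (bc : Side → BC) (C : ℝ) : Prop where
  size_le : ∀ k, (d.elem k).size ≤
    C * ((d.elem k).bdry Side.right - (d.elem k).bdry Side.left)
  size_le_nbr : ∀ γ k v, d.nbr γ k = some v → (d.elem k).size ≤ C * (d.elem v).size
  R_le : ∀ k γ i, |(d.elem k).R γ i| ≤ C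
  w_le : ∀ k i, (d.elem k).w i ≤ C * (d.elem k).size
  D_le : ∀ k i j, |(d.elem k).D i j| * (d.elem k).size ≤ C
  Db_le : ∀ k i j, |(d.elem k).Db i j| * (d.elem k).size ≤ C
  Mbar_le : ∀ k l i j, |(d.elem k).Mbar l i j| * (d.elem k).size ≤ C
  T1_le : ∀ γ k v, d.nbr γ k = some v → |d.T1 γ k| * (d.elem k).size ≤ C
  T2_le : ∀ γ k v, d.nbr γ k = some v → |d.T2 γ k| ≤ C
  T3_le : ∀ γ k v, d.nbr γ k = some v → |d.T3 γ k| ≤ C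
  T4_le : ∀ γ k v, d.nbr γ k = some v → |d.T4 γ k| ≤ C * (d.elem k).size
  TD_le : ∀ γ k, d.nbr γ k = none → bc γ = BC.dirichlet → |d.TD γ| * (d.elem k).size ≤ C

/-- The conditions on the SAT coefficients at the interfaces, and the symmetry of the matrices `M`,
under which the discrete adjoint problem is a consistent discretization of the adjoint problem. -/
structure AdjointConsistent (lam : ℝ → ℝ) : Prop where
  T1_eq : ∀ γ k v, d.nbr γ k = some v → d.T1 γ k = d.T1 γ.opp v
  T2_eq : ∀ γ k v, d.nbr γ k = some v → d.T2 γ k + 1 = -d.T2 γ.opp v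
  T3_eq : ∀ γ k v, d.nbr γ k = some v → d.T3 γ k - 1 = -d.T3 γ.opp v
  T4_eq : ∀ γ k v, d.nbr γ k = some v → d.T4 γ k = d.T4 γ.opp v
  M_symm : ∀ k, (d.elem k).M lam = ((d.elem k).M lam)ᵀ

variable (bc : Side → BC) (lam : ℝ → ℝ) (data : Side → ℝ) (v : Fin d.ne → Fin n → ℝ)

/-- `R_γ v` on element `k`. -/
def tr (γ : Side) (k : Fin d.ne) : ℝ := (d.elem k).R γ ⬝ᵥ v k

/-- `D_γ v` on element `k`. -/
def fl (γ : Side) (k : Fin d.ne) : ℝ := (d.elem k).Dn lam γ ⬝ᵥ v k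

/-- The boundary SAT at the end `γ` of the domain, which belongs to element `k`; the same for the
primal and the adjoint problem. -/
def boundarySAT (γ : Side) (k : Fin d.ne) : Fin n → ℝ :=
  match bc γ with
  | BC.dirichlet =>
      (d.tr v γ k - data γ) • (d.TD γ • (d.elem k).R γ - (d.elem k).Dn lam γ)
  | BC.neumann => (d.fl lam v γ k - data γ) • (d.elem k).R γ

/-- The interface SAT of the primal problem at the end `γ` of element `k`, with neighbour `m`. -/
def interfaceSAT (γ : Side) (k m : Fin d.ne) : Fin n → ℝ :=
  (d.T1 γ k * (d.tr v γ k - d.tr v γ.opp m) +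
    d.T3 γ k * (d.fl lam v γ k + d.fl lam v γ.opp m)) • (d.elem k).R γ +
  (d.T2 γ k * (d.tr v γ k - d.tr v γ.opp m) +
    d.T4 γ k * (d.fl lam v γ k + d.fl lam v γ.opp m)) • (d.elem k).Dn lam γ

/-- The interface SAT of the adjoint problem at the end `γ` of element `k`, with neighbour `m`. -/
def interfaceSATAdj (γ : Side) (k m : Fin d.ne) : Fin n → ℝ :=
  (d.T1 γ k * d.tr v γ k - d.T1 γ.opp m * d.tr v γ.opp m +
    (d.T2 γ k + 1) * d.fl lam v γ k - d.T2 γ.opp m * d.fl lam v γ.opp m) • (d.elem k).R γ +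
  ((d.T3 γ k - 1) * d.tr v γ k + d.T3 γ.opp m * d.tr v γ.opp m +
    d.T4 γ k * d.fl lam v γ k + d.T4 γ.opp m * d.fl lam v γ.opp m) • (d.elem k).Dn lam γ

/-- The sum of the interface and boundary SATs of the primal problem on element `k`. -/
def sat (k : Fin d.ne) : Fin n → ℝ :=
  ∑ γ : Side, match d.nbr γ k with
    | some m => d.interfaceSAT lam v γ k m
    | none => d.boundarySAT bc lam data v γ k

/-- The sum of the interface and boundary SATs of the adjoint problem on element `k`. -/
def satAdj (k : Fin d.ne) : Fin n → ℝ :=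
  ∑ γ : Side, match d.nbr γ k with
    | some m => d.interfaceSATAdj lam v γ k m
    | none => d.boundarySAT bc lam data v γ k

/-- `v` solves the steady SBP-SAT discretization of the primal problem with source `F` and boundary
data `data = (u_D, u_N)`. -/
def SolvesPrimal (F : ℝ → ℝ) : Prop :=
  ∀ k, (d.elem k).D2 lam *ᵥ v k + (d.elem k).restrict F
    - ((d.elem k).H)⁻¹ *ᵥ d.sat bc lam data v k = 0

/-- `v` solves the discrete adjoint problem with source `G` and boundary data
`data = (ψ_D, ψ_N)`. -/
def SolvesAdjoint (G : ℝ → ℝ) : Prop :=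
  ∀ k, (d.elem k).D2 lam *ᵥ v k + (d.elem k).restrict G
    + ((d.elem k).H)⁻¹ *ᵥ (((d.elem k).M lam - ((d.elem k).M lam)ᵀ) *ᵥ v k)
    - ((d.elem k).H)⁻¹ *ᵥ d.satAdj bc lam data v k = 0

/-- `v` approximates the function `V` to order `h ^ r` in the maximum norm, with constant `C`. -/
def Accurate (V : ℝ → ℝ) (r : ℕ) (C : ℝ) : Prop :=
  ∀ k i, |V ((d.elem k).node i) - v k i| ≤ C * d.h ^ r

/-- The discrete functional
`∑_k wᵀ H v_k + ∑_{Dirichlet ends} (-dataF D_γ v + dataF T⁽ᴰ⁾ (R_γ v - data))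
  + ∑_{Neumann ends} dataF R_γ v`, where `w` is the restriction of `W`.
`I_h(u_h)` is the case `W = G`, `dataF = (ψ_D, ψ_N)`, `data = (u_D, u_N)`, and `I_h(ψ_h)` the case
`W = F`, `dataF = (u_D, u_N)`, `data = (ψ_D, ψ_N)`. -/
def discreteFunctional (W : ℝ → ℝ) (dataF : Side → ℝ) : ℝ :=
  (∑ k, (d.elem k).restrict W ⬝ᵥ ((d.elem k).H *ᵥ v k)) +
    ∑ k, ∑ γ : Side, match d.nbr γ k, bc γ with
      | some _, _ => 0
      | none, BC.dirichlet =>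
          -(dataF γ * d.fl lam v γ k) + dataF γ * d.TD γ * (d.tr v γ k - data γ)
      | none, BC.neumann => dataF γ * d.tr v γ k

end Discretization

end

/-
The matrices `M̄ᵢ` are positive semidefinite, so scalar identities obtained from summation by parts
force `M̄ᵢ` to see polynomials of degree at most `p` only through their derivative at the node `i`.
Hence the defect of the symmetric form `M(f)` as an approximation of `∫ f u' v'`, corrected by the
extrapolation errors at the ends, vanishes on polynomials of total degree at most `2 * p + 1`, twice
the order of the operators themselves, and is `O(h ^ (2 * p + 1))` on an element of size `h` by
Taylor expansion.

By adjoint consistency the discrete adjoint problem is the dual of the discrete primal problem, so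
the error of the functional is the consistency error of the primal problem tested with `ψ`, plus the
same consistency error tested with the error of the discrete adjoint solution. The second is a
product of errors of `U` and `ψ`; the first reduces to the defects above, quadrature errors, and
products of extrapolation errors of `U` and `ψ` at the faces.
-/

noncomputable section

/-! ### Taylor expansion and jets -/

section Taylor

open Asymptotics Filter

variable {α : Type*} {a b : ℝ}

/-- The coefficient of `(x - c) ^ i` in the Taylor expansion of `V` at `c ∈ [a, b]`. -/
def taylorCoeff (a b : ℝ) (V : ℝ → ℝ) (i : ℕ) (c : ℝ) : ℝ :=
  iteratedDerivWithin i V (Icc a b) c / i.factorial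

theorem isBigO_one_of_continuousOn {V : ℝ → ℝ} (hV : ContinuousOn V (Icc a b)) {y : α → ℝ}
    (hy : ∀ x, y x ∈ Icc a b) : (fun x => V (y x)) =O[⊤] (fun _ => (1 : ℝ)) := by
  obtain ⟨K, hK⟩ := isCompact_Icc.exists_bound_of_continuousOn hV
  exact isBigO_top.mpr ⟨K, fun x => by simpa using hK _ (hy x)⟩

theorem taylorCoeff_isBigO_one (hab : a < b) {V : ℝ → ℝ} {m i : ℕ} (hi : i ≤ m)
    (hV : ContDiffOn ℝ m V (Icc a b)) {c : α → ℝ} (hc : ∀ x, c x ∈ Icc a b) :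
    (fun x => taylorCoeff a b V i (c x)) =O[⊤] (fun _ => (1 : ℝ)) :=
  isBigO_one_of_continuousOn ((hV.continuousOn_iteratedDerivWithin (by exact_mod_cast hi)
    (uniqueDiffOn_Icc hab)).div_const _) hc

theorem taylorCoeff_succ_mul (a b : ℝ) (V : ℝ → ℝ) (i : ℕ) (c : ℝ) :
    taylorCoeff a b V (i + 1) c * (i + 1) = taylorCoeff a b (derivWithin V (Icc a b)) i c := by
  rw [taylorCoeff, taylorCoeff, iteratedDerivWithin_succ', Nat.factorial_succ]
  push_cast
  field_simp

theorem sub_taylor_isBigO (hab : a < b) {V : ℝ → ℝ} {m : ℕ} (hV : ContDiffOn ℝ m V (Icc a b))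
    {c y : α → ℝ} (hc : ∀ x, c x ∈ Icc a b) (hy : ∀ x, y x ∈ Icc a b) :
    (fun x => V (y x) - ∑ i ∈ Finset.range m, taylorCoeff a b V i (c x) * (y x - c x) ^ i)
      =O[⊤] fun x => (y x - c x) ^ m := by
  rcases m with _ | m
  · simpa using isBigO_one_of_continuousOn hV.continuousOn hy
  have hsum (t z : ℝ) : taylorWithinEval V m (Icc a b) t z =
      ∑ i ∈ Finset.range (m + 1), taylorCoeff a b V i t * (z - t) ^ i := by
    simp only [taylor_within_apply, taylorCoeff, smul_eq_mul]
    exact Finset.sum_congr rfl fun i _ => by ring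
  have hunique := uniqueDiffOn_Icc hab
  obtain ⟨K, hK⟩ := isCompact_Icc.exists_bound_of_continuousOn
    (hV.continuousOn_iteratedDerivWithin (m := m + 1) le_rfl hunique)
  refine isBigO_top.mpr ⟨K, fun x => ?_⟩
  have hsub : uIcc (c x) (y x) ⊆ Icc a b := (convex_Icc a b).ordConnected.uIcc_subset (hc x) (hy x)
  -- As a function of its centre, the Taylor polynomial has a derivative with only one term.
  have hderiv : ∀ t ∈ uIcc (c x) (y x),
      HasDerivWithinAt (fun t => taylorWithinEval V m (Icc a b) t (y x))
        (((m.factorial : ℝ)⁻¹ * (y x - t) ^ m) • iteratedDerivWithin (m + 1) V (Icc a b) t)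
        (uIcc (c x) (y x)) t := fun t ht =>
    (hasDerivWithinAt_taylorWithinEval_at_Icc (y x) hab (hsub ht) (hV.of_le (by norm_cast; omega))
      (hV.differentiableOn_iteratedDerivWithin (by norm_cast; omega) hunique)).mono hsub
  have hbound : ∀ t ∈ uIcc (c x) (y x), ‖((m.factorial : ℝ)⁻¹ * (y x - t) ^ m) •
      iteratedDerivWithin (m + 1) V (Icc a b) t‖ ≤ |y x - c x| ^ m * K := fun t ht => by
    have hfact : (m.factorial : ℝ)⁻¹ ≤ 1 :=
      inv_le_one_of_one_le₀ (by exact_mod_cast m.factorial_pos)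
    rw [norm_smul, norm_mul, norm_pow, Real.norm_of_nonneg (by positivity), Real.norm_eq_abs]
    refine mul_le_mul ?_ (hK t (hsub ht)) (norm_nonneg _) (by positivity)
    exact (mul_le_of_le_one_left (by positivity) hfact).trans
      (pow_le_pow_left₀ (abs_nonneg _) (abs_sub_right_of_mem_uIcc ht) m)
  have hmean := (convex_uIcc _ _).norm_image_sub_le_of_norm_hasDerivWithin_le hderiv hbound
    left_mem_uIcc right_mem_uIcc
  rw [taylorWithinEval_self, hsum] at hmean
  refine hmean.trans_eq ?_
  rw [norm_pow, Real.norm_eq_abs]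
  ring

end Taylor

/-- A pair of functions in the roles of a function and its derivative. Estimates are proved for
linear functionals of jets, so that the derivative of a Taylor remainder need not be related to
the remainder itself. -/
abbrev Jet := (ℝ → ℝ) × (ℝ → ℝ)

namespace Jet

open Asymptotics Filter

/-- The jet of a function on `[a, b]`, with one-sided derivatives at the end points. -/
def of (a b : ℝ) (V : ℝ → ℝ) : Jet := (V, derivWithin V (Icc a b))

/-- The jet of a polynomial, to which the exactness of the discrete operators refers. -/
def ofPoly (P : ℝ[X]) : Jet := (fun x => P.eval x, fun x => P.derivative.eval x)

/-- The jet of the monomial `(x - c) ^ i`. -/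
def mono (c : ℝ) (i : ℕ) : Jet := ofPoly ((X - C c) ^ i)

variable {α : Type*} {a b : ℝ} {c ρ : α → ℝ}

/-- The jets `f x` are `O(g x)` at the scale `ρ x` around `c x`: this bounds the functions, and
`ρ x` times the derivatives, at all points of `[a, b]` whose distance from `c x` is `O(ρ x)`. -/
structure IsBigOAt (a b : ℝ) (c ρ : α → ℝ) (f : α → Jet) (g : α → ℝ) : Prop where
  fst ⦃y : α → ℝ⦄ (hy : ∀ x, y x ∈ Icc a b) (hyc : (fun x => y x - c x) =O[⊤] ρ) :
    (fun x => (f x).1 (y x)) =O[⊤] g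
  snd ⦃y : α → ℝ⦄ (hy : ∀ x, y x ∈ Icc a b) (hyc : (fun x => y x - c x) =O[⊤] ρ) :
    (fun x => ρ x * (f x).2 (y x)) =O[⊤] g

theorem isBigO_mono (a b : ℝ) (c ρ : α → ℝ) (i : ℕ) :
    IsBigOAt a b c ρ (fun x => mono (c x) i) fun x => ρ x ^ i where
  fst _ _ hyc := by simpa [mono, ofPoly] using hyc.pow i
  snd y _ hyc := by
    rcases i with _ | i
    · simp only [mono, ofPoly, pow_zero, derivative_one, eval_zero, mul_zero]
      exact isBigO_zero _ _
    · refine (((isBigO_refl ρ ⊤).mul (hyc.pow i)).const_mul_left (i + 1 : ℝ)).congr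
        (fun x => ?_) fun x => (pow_succ' _ _).symm
      simp [mono, ofPoly, derivative_X_sub_C_pow, mul_left_comm]

theorem isBigO_of_one (hab : a < b) {V : ℝ → ℝ} (hV : ContDiffOn ℝ 1 V (Icc a b))
    (hρ : ρ =O[⊤] fun _ => (1 : ℝ)) : IsBigOAt a b c ρ (fun _ => of a b V) fun _ => 1 where
  fst _ hy _ := isBigO_one_of_continuousOn hV.continuousOn hy
  snd _ hy _ := by
    simpa [of] using hρ.mul (isBigO_one_of_continuousOn
      (hV.continuousOn_derivWithin (uniqueDiffOn_Icc hab) le_rfl) hy)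

theorem isBigO_of_sub_taylor (hab : a < b) {V : ℝ → ℝ} {m : ℕ} (hm : m ≠ 0)
    (hV : ContDiffOn ℝ m V (Icc a b)) (hc : ∀ x, c x ∈ Icc a b) :
    IsBigOAt a b c ρ
      (fun x => of a b V - ∑ i ∈ Finset.range m, taylorCoeff a b V i (c x) • mono (c x) i)
      fun x => ρ x ^ m where
  fst y hy hyc := by
    simpa [of, mono, ofPoly, Prod.fst_sum] using (sub_taylor_isBigO hab hV hc hy).trans (hyc.pow m)
  snd y hy hyc := by
    obtain ⟨m, rfl⟩ := Nat.exists_eq_succ_of_ne_zero hm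
    have hV' : ContDiffOn ℝ m (derivWithin V (Icc a b)) (Icc a b) :=
      hV.derivWithin (uniqueDiffOn_Icc hab) (by norm_cast)
    refine ((isBigO_refl ρ ⊤).mul ((sub_taylor_isBigO hab hV' hc hy).trans (hyc.pow m))).congr
      (fun x => ?_) fun x => (pow_succ' _ _).symm
    simp [of, mono, ofPoly, derivative_X_sub_C_pow, Prod.snd_sum, Finset.sum_range_succ',
      ← mul_assoc, taylorCoeff_succ_mul]

/-- A Bramble–Hilbert lemma, uniform in the index `x`. -/
theorem isBigO_apply_of (hab : a < b) {V : ℝ → ℝ} {m : ℕ} (hm : m ≠ 0)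
    (hV : ContDiffOn ℝ m V (Icc a b)) (hc : ∀ x, c x ∈ Icc a b) {L : α → Jet → ℝ} {g : α → ℝ}
    (hL : ∀ x, IsLinearMap ℝ (L x))
    (hmono : ∀ i < m, (fun x => L x (mono (c x) i)) =O[⊤] g)
    (hrem : ∀ f : α → Jet, IsBigOAt a b c ρ f (fun x => ρ x ^ m) →
      (fun x => L x (f x)) =O[⊤] g) :
    (fun x => L x (of a b V)) =O[⊤] g := by
  have hpoly : (fun x => ∑ i ∈ Finset.range m, taylorCoeff a b V i (c x) * L x (mono (c x) i))
      =O[⊤] g := IsBigO.fun_sum fun i hi => by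
    have hi := Finset.mem_range.mp hi
    simpa using (taylorCoeff_isBigO_one hab hi.le hV hc).mul (hmono i hi)
  refine ((hrem _ (isBigO_of_sub_taylor hab hm hV hc)).add hpoly).congr_left fun x => ?_
  change IsLinearMap.mk' (L x) (hL x) _ + _ = _
  rw [map_sub, map_sum]
  simp [IsLinearMap.mk'_apply]

/- Constants in the second slot are killed, so every product with the remainder of `f` carries a
further factor `ρ x`: this is why `f` may be one derivative less smooth than `V`. -/
theorem isBigO_apply_of_of (hab : a < b) {f V : ℝ → ℝ} {m : ℕ} (hm : m ≠ 0)
    (hf : ContDiffOn ℝ m f (Icc a b)) (hV : ContDiffOn ℝ ((m + 1 : ℕ) : WithTop ℕ∞) V (Icc a b))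
    (hc : ∀ x, c x ∈ Icc a b) (hρ : ρ =O[⊤] fun _ => (1 : ℝ)) {B : α → Jet → Jet → ℝ} {g : α → ℝ}
    (hleft : ∀ x u, IsLinearMap ℝ fun f => B x f u) (hright : ∀ x f, IsLinearMap ℝ (B x f))
    (hconst : ∀ x f, B x f (mono (c x) 0) = 0)
    (hmono : ∀ i j, i + j ≤ m → (fun x => B x (mono (c x) i) (mono (c x) j)) =O[⊤] g)
    (hbound : ∀ (f u : α → Jet) (i j : ℕ), m + 1 ≤ i + j →
      IsBigOAt a b c ρ f (fun x => ρ x ^ i) → IsBigOAt a b c ρ u (fun x => ρ x ^ j) →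
      (fun x => B x (f x) (u x)) =O[⊤] g) :
    (fun x => B x (of a b f) (of a b V)) =O[⊤] g := by
  refine isBigO_apply_of hab m.succ_ne_zero hV hc (fun x => hright x _) (fun j hj => ?_)
    fun u hu => hbound _ u 0 (m + 1) (by omega)
      (by simpa using isBigO_of_one hab (hf.of_le (by exact_mod_cast Nat.pos_of_ne_zero hm)) hρ) hu
  rcases Nat.eq_zero_or_pos j with rfl | hj0
  · simpa only [hconst] using isBigO_zero _ _
  refine isBigO_apply_of hab hm hf hc (fun x => hleft x _) (fun i _ => ?_)
    fun f hf => hbound f _ m j (by omega) hf (isBigO_mono a b c ρ j)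
  by_cases hij : i + j ≤ m
  · exact hmono i j hij
  · exact hbound _ _ i j (by omega) (isBigO_mono a b c ρ i) (isBigO_mono a b c ρ j)

end Jet

/-! ### Summation by parts and exactness on polynomials -/

theorem natDegree_mul_derivative_le {f P : ℝ[X]} {m : ℕ} (h : f.natDegree + P.natDegree ≤ m + 1) :
    (f * derivative P).natDegree ≤ m := by
  rcases Nat.eq_zero_or_pos P.natDegree with hP | hP
  · simp [derivative_of_natDegree_zero hP]
  · have := natDegree_derivative_le P
    exact natDegree_mul_le.trans (by omega)

namespace SBPElement

variable {n : ℕ} (E : SBPElement n)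

theorem dotProduct_H_mulVec (v q : Fin n → ℝ) : v ⬝ᵥ (E.H *ᵥ q) = ∑ i, E.w i * v i * q i := by
  simp only [dotProduct, H, mulVec_diagonal]
  exact Finset.sum_congr rfl fun i _ => by ring

theorem dotProduct_Emat_mulVec (v q : Fin n → ℝ) :
    v ⬝ᵥ (E.Emat *ᵥ q) = ∑ γ : Side, γ.normal * ((E.R γ ⬝ᵥ v) * (E.R γ ⬝ᵥ q)) := by
  simp [Emat, sum_mulVec, sum_dotProduct, smul_mulVec, vecMulVec_mulVec, dotProduct_comm v,
    mul_comm]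

theorem dotProduct_M_mulVec (lam : ℝ → ℝ) (v u : Fin n → ℝ) :
    v ⬝ᵥ (E.M lam *ᵥ u) = ∑ l, lam (E.node l) * (v ⬝ᵥ (E.Mbar l *ᵥ u)) := by
  simp [M, sum_mulVec, dotProduct_sum, smul_mulVec]

theorem Dn_dotProduct (lam : ℝ → ℝ) (γ : Side) (u : Fin n → ℝ) :
    E.Dn lam γ ⬝ᵥ u = γ.normal * ∑ i, E.R γ i * (lam (E.node i) * (E.Db *ᵥ u) i) := by
  rw [Dn, smul_dotProduct, smul_eq_mul, ← dotProduct_mulVec, ← mulVec_mulVec]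
  simp [dotProduct, Lam, mulVec_diagonal, restrict]

variable {E} {p : ℕ}

namespace IsSBP

theorem isUnit_det_H (hE : E.IsSBP p) : IsUnit E.H.det := by
  rw [H, det_diagonal]
  exact (Finset.prod_ne_zero_iff.mpr fun i _ => (hE.w_pos i).ne').isUnit

theorem Emat_eq (hE : E.IsSBP p) : E.Emat = E.H * E.D + E.Dᵀ * E.H := by
  obtain ⟨S, hS, hD⟩ := hE.decomposition
  have hHt : (E.H)ᵀ = E.H := diagonal_transpose _
  have hEt : (E.Emat)ᵀ = E.Emat := by simp [Emat, transpose_sum, transpose_vecMulVec]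
  have hHD : E.H * E.D = S + (1 / 2 : ℝ) • E.Emat := by
    rw [hD, mul_nonsing_inv_cancel_left _ _ hE.isUnit_det_H]
  have hDH : E.Dᵀ * E.H = -S + (1 / 2 : ℝ) • E.Emat := by
    have := congrArg transpose hHD
    rwa [transpose_mul, hHt, transpose_add, hS, transpose_smul, hEt] at this
  rw [hHD, hDH]
  module

theorem sum_by_parts (hE : E.IsSBP p) (v q : Fin n → ℝ) :
    ∑ i, E.w i * (E.D *ᵥ v) i * q i + ∑ i, E.w i * v i * (E.D *ᵥ q) i =
      ∑ γ : Side, γ.normal * ((E.R γ ⬝ᵥ v) * (E.R γ ⬝ᵥ q)) := by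
  rw [← dotProduct_Emat_mulVec, hE.Emat_eq, ← dotProduct_H_mulVec, ← dotProduct_H_mulVec,
    add_mulVec, dotProduct_add, ← mulVec_mulVec, ← mulVec_mulVec, dotProduct_mulVec v E.Dᵀ,
    vecMul_transpose, add_comm]

theorem sum_w_mul_D2 (hE : E.IsSBP p) (lam : ℝ → ℝ) (v u : Fin n → ℝ) :
    ∑ i, E.w i * v i * (E.D2 lam *ᵥ u) i =
      -(v ⬝ᵥ (E.M lam *ᵥ u)) + ∑ γ : Side, (E.R γ ⬝ᵥ v) * (E.Dn lam γ ⬝ᵥ u) := by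
  rw [← dotProduct_H_mulVec, mulVec_mulVec, D2,
    mul_nonsing_inv_cancel_left _ _ hE.isUnit_det_H, add_mulVec, dotProduct_add, neg_mulVec,
    dotProduct_neg, Matrix.mul_assoc, ← mulVec_mulVec, dotProduct_Emat_mulVec]
  congr 1
  refine Finset.sum_congr rfl fun γ _ => ?_
  rw [Dn, smul_dotProduct, smul_eq_mul, ← dotProduct_mulVec]
  ring

/- Summation by parts, with `P` split into two factors of degree at most `p`. -/
theorem quadrature_eval (hE : E.IsSBP p) {P : ℝ[X]} (hP : P.natDegree ≤ 2 * p) :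
    ∑ i, E.w i * P.derivative.eval (E.node i) =
      ∑ γ : Side, γ.normal * P.eval (E.bdry γ) := by
  refine induction_with_natDegree_le (motive := fun P : ℝ[X] =>
    ∑ i, E.w i * P.derivative.eval (E.node i) = ∑ γ : Side, γ.normal * P.eval (E.bdry γ))
    (2 * p) (by simp) (fun m r _ hm => ?_) (fun P Q _ _ hP hQ => ?_) P hP
  · obtain ⟨s, t, hs, ht, rfl⟩ : ∃ s t, s ≤ p ∧ t ≤ p ∧ m = s + t :=
      ⟨min m p, m - min m p, by omega, by omega, by omega⟩
    have hs' : (C r * X ^ s).natDegree ≤ p := (natDegree_C_mul_X_pow_le r s).trans hs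
    have ht' : (X ^ t : ℝ[X]).natDegree ≤ p := (natDegree_X_pow_le t).trans ht
    have h := hE.sum_by_parts (E.restrict fun x => (C r * X ^ s).eval x)
      (E.restrict fun x => (X ^ t : ℝ[X]).eval x)
    rw [hE.accurate _ hs', hE.accurate _ ht', ← Finset.sum_add_distrib] at h
    simp only [hE.extrapolation _ _ hs', hE.extrapolation _ _ ht'] at h
    rw [pow_add, ← mul_assoc]
    simp only [derivative_mul (f := C r * X ^ s), eval_add, eval_mul (p := C r * X ^ s),
      eval_mul (p := derivative _)]
    simpa only [restrict, mul_add, mul_assoc] using h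
  · simp only [derivative_add, eval_add, mul_add, Finset.sum_add_distrib, hP, hQ]

section Exactness

variable (hE : E.IsSBP p) (hk : E.IsNarrow p ∨ E.IsWide)
include hE hk

theorem Mbar_posSemidef (l : Fin n) : (E.Mbar l).PosSemidef := by
  rcases hk with hk | hk
  · exact hk.posSemidef l
  · simpa [hk.Mbar_eq] using (posSemidef_vecMulVec_self_star (E.D l)).smul (hE.w_pos l).le

theorem Mbar_comm (l : Fin n) (u v : Fin n → ℝ) :
    v ⬝ᵥ (E.Mbar l *ᵥ u) = u ⬝ᵥ (E.Mbar l *ᵥ v) := by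
  have h : (E.Mbar l)ᵀ = E.Mbar l := by
    simpa [IsHermitian] using (hE.Mbar_posSemidef hk l).isHermitian
  rw [dotProduct_mulVec, ← mulVec_transpose, h, dotProduct_comm]

theorem M_comm (lam : ℝ → ℝ) (u v : Fin n → ℝ) :
    v ⬝ᵥ (E.M lam *ᵥ u) = u ⬝ᵥ (E.M lam *ᵥ v) := by
  simp only [dotProduct_M_mulVec, hE.Mbar_comm hk _ u v]

theorem R_mul_Db_eval {P : ℝ[X]} (hP : P.natDegree ≤ p) (γ : Side) (i : Fin n) :
    E.R γ i * (E.Db *ᵥ E.restrict fun x => P.eval x) i =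
      E.R γ i * P.derivative.eval (E.node i) := by
  rcases eq_or_ne (E.R γ i) 0 with hi | hi
  · simp [hi]
  rcases hk with hk | hk
  · rw [hk.Db_accurate P (by omega) i ⟨γ, hi⟩]
  · rw [hk.Db_eq, hE.accurate P hP, restrict]

theorem sum_R_mul_Db_eval {f P : ℝ[X]} (hP : P.natDegree ≤ p)
    (hfP : f.natDegree + P.natDegree ≤ p + 1) (γ : Side) :
    ∑ i, E.R γ i * (f.eval (E.node i) * (E.Db *ᵥ E.restrict fun x => P.eval x) i) =
      (f * derivative P).eval (E.bdry γ) := by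
  rw [← hE.extrapolation γ _ (natDegree_mul_derivative_le hfP), dotProduct]
  refine Finset.sum_congr rfl fun i _ => ?_
  rw [mul_left_comm, hE.R_mul_Db_eval hk hP, restrict, eval_mul, mul_left_comm]

end Exactness

theorem dotProduct_M_mulVec_eval_of_isNarrow (hE : E.IsSBP p) (hk : E.IsNarrow p) {f P : ℝ[X]}
    (hP : P.natDegree ≤ p) (hfP : f.natDegree + P.natDegree ≤ p + 1) (v : Fin n → ℝ) :
    v ⬝ᵥ (E.M (fun x => f.eval x) *ᵥ E.restrict fun x => P.eval x) =
      ∑ γ : Side, γ.normal * ((E.R γ ⬝ᵥ v) * (f * derivative P).eval (E.bdry γ)) -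
      ∑ i, E.w i * v i * (derivative (f * derivative P)).eval (E.node i) := by
  have h := hE.sum_w_mul_D2 (fun x => f.eval x) v (E.restrict fun x => P.eval x)
  simp only [hk.accurate f P (natDegree_mul_le.trans hfP), Dn_dotProduct,
    hE.sum_R_mul_Db_eval (.inl hk) hP hfP, restrict, mul_left_comm _ (Side.normal _)] at h
  simp only [h]
  ring

theorem dotProduct_M_mulVec_eval_of_isWide (hE : E.IsSBP p) (hk : E.IsWide) {f P : ℝ[X]}
    (hP : P.natDegree ≤ p) (hfP : f.natDegree + P.natDegree ≤ p + 1) (v : Fin n → ℝ) :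
    v ⬝ᵥ (E.M (fun x => f.eval x) *ᵥ E.restrict fun x => P.eval x) =
      ∑ γ : Side, γ.normal * ((E.R γ ⬝ᵥ v) * (f * derivative P).eval (E.bdry γ)) -
      ∑ i, E.w i * v i * (derivative (f * derivative P)).eval (E.node i) := by
  have hq := natDegree_mul_derivative_le hfP
  have h := hE.sum_by_parts v (E.restrict fun x => (f * derivative P).eval x)
  simp only [hE.accurate _ hq, hE.extrapolation _ _ hq] at h
  rw [← h, M_eq_of_isWide E hk, ← mulVec_mulVec, hE.accurate P hP, Matrix.mul_assoc,
    ← mulVec_mulVec, dotProduct_mulVec, vecMul_transpose, ← mulVec_mulVec, dotProduct_H_mulVec]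
  simp [Lam, mulVec_diagonal, restrict]

theorem dotProduct_M_mulVec_eval (hE : E.IsSBP p) (hk : E.IsNarrow p ∨ E.IsWide) {f P : ℝ[X]}
    (hP : P.natDegree ≤ p) (hfP : f.natDegree + P.natDegree ≤ p + 1) (v : Fin n → ℝ) :
    v ⬝ᵥ (E.M (fun x => f.eval x) *ᵥ E.restrict fun x => P.eval x) =
      ∑ γ : Side, γ.normal * ((E.R γ ⬝ᵥ v) * (f * derivative P).eval (E.bdry γ)) -
      ∑ i, E.w i * v i * (derivative (f * derivative P)).eval (E.node i) :=
  hk.elim (hE.dotProduct_M_mulVec_eval_of_isNarrow · hP hfP v)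
    (hE.dotProduct_M_mulVec_eval_of_isWide · hP hfP v)

end IsSBP

end SBPElement

namespace SBPElement

variable {n p : ℕ} {E : SBPElement n}

/-- The defect of `M(f)` as an approximation of the form `∫ f u' v'` on the element, corrected by
the extrapolation errors at its ends. -/
def formDefect (E : SBPElement n) (f u v : Jet) : ℝ :=
  E.restrict v.1 ⬝ᵥ (E.M f.1 *ᵥ E.restrict u.1) -
    ∑ i, E.w i * (f.1 (E.node i) * (u.2 (E.node i) * v.2 (E.node i))) -
    ∑ γ : Side, γ.normal * (f.1 (E.bdry γ) *
      (u.2 (E.bdry γ) * (E.R γ ⬝ᵥ E.restrict v.1 - v.1 (E.bdry γ)) +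
        v.2 (E.bdry γ) * (E.R γ ⬝ᵥ E.restrict u.1 - u.1 (E.bdry γ))))

/-- The consistency error of the interior operator, tested with `ε`: the defect of summation by
parts with the exact flux at the ends and the numerical derivative of the flux at the nodes. -/
def residualForm (E : SBPElement n) (ε : Fin n → ℝ) (f u : Jet) : ℝ :=
  ε ⬝ᵥ (E.M f.1 *ᵥ E.restrict u.1) -
    ∑ γ : Side, γ.normal * ((E.R γ ⬝ᵥ ε) * (f.1 (E.bdry γ) * u.2 (E.bdry γ))) +
    ∑ i, E.w i * ε i * (E.D *ᵥ E.restrict (f.1 * u.2)) i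

namespace IsSBP

section Exactness

variable (hE : E.IsSBP p) (hk : E.IsNarrow p ∨ E.IsWide)
include hE hk

theorem dotProduct_M_mulVec_eval_eval {f P Q : ℝ[X]} (hP : P.natDegree ≤ p) (hQ : Q.natDegree ≤ p)
    (hfP : f.natDegree + P.natDegree ≤ p + 1)
    (hfPQ : f.natDegree + P.natDegree + Q.natDegree ≤ 2 * p + 1) :
    E.restrict (fun x => Q.eval x) ⬝ᵥ
        (E.M (fun x => f.eval x) *ᵥ E.restrict fun x => P.eval x) =
      ∑ i, E.w i * (f * derivative P * derivative Q).eval (E.node i) := by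
  have hq : (f * derivative P).natDegree ≤ 2 * p - Q.natDegree :=
    natDegree_mul_derivative_le (by omega)
  have h := hE.quadrature_eval (P := Q * (f * derivative P)) (natDegree_mul_le.trans (by omega))
  simp only [hE.dotProduct_M_mulVec_eval hk hP hfP, hE.extrapolation _ Q hQ, ← eval_mul]
  rw [← h, ← Finset.sum_sub_distrib]
  refine Finset.sum_congr rfl fun i _ => ?_
  rw [derivative_mul]
  simp only [restrict, eval_add, eval_mul]
  ring

theorem Mbar_mulVec_eq_zero {z : Fin n → Fin n → ℝ} (hz : ∑ s, z s ⬝ᵥ (E.Mbar s *ᵥ z s) = 0)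
    (s : Fin n) : E.Mbar s *ᵥ z s = 0 := by
  have hM := hE.Mbar_posSemidef hk
  have hnonneg : ∀ s ∈ Finset.univ, 0 ≤ z s ⬝ᵥ (E.Mbar s *ᵥ z s) := fun s _ => by
    simpa using (hM s).dotProduct_mulVec_nonneg (z s)
  exact ((hM s).dotProduct_mulVec_zero_iff _).mp
    ((Finset.sum_eq_zero_iff_of_nonneg hnonneg).mp hz s (Finset.mem_univ s))

theorem Mbar_mulVec_const (r : ℝ) (s : Fin n) : (E.Mbar s *ᵥ E.restrict fun _ => r) = 0 := by
  refine hE.Mbar_mulVec_eq_zero hk (z := fun _ => E.restrict fun _ => r) ?_ s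
  simpa [dotProduct_M_mulVec] using hE.dotProduct_M_mulVec_eval_eval hk (f := 1) (P := C r)
    (Q := C r) (by simp) (by simp) (by simp) (by simp)

theorem Mbar_mulVec_pow_succ {m : ℕ} (hm : m + 1 ≤ p) (s : Fin n) :
    (m : ℝ) • (E.Mbar s *ᵥ E.restrict fun x => x ^ (m + 1)) =
      ((m + 1) * E.node s) • (E.Mbar s *ᵥ E.restrict fun x => x ^ m) := by
  set y := E.restrict fun x => x ^ m
  set z := E.restrict fun x => x ^ (m + 1)
  -- Positivity turns one scalar identity into one vector identity for every node.
  suffices h : ∑ s, ((m : ℝ) • z - ((m + 1) * E.node s) • y) ⬝ᵥ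
      (E.Mbar s *ᵥ ((m : ℝ) • z - ((m + 1) * E.node s) • y)) = 0 by
    simpa [mulVec_sub, mulVec_smul, sub_eq_zero] using hE.Mbar_mulVec_eq_zero hk h s
  have hzz := hE.dotProduct_M_mulVec_eval_eval hk (f := 1) (P := X ^ (m + 1)) (Q := X ^ (m + 1))
    (by simpa) (by simpa) (by simp; omega) (by simp; omega)
  have hyz := hE.dotProduct_M_mulVec_eval_eval hk (f := X) (P := X ^ m) (Q := X ^ (m + 1))
    (by simp; omega) (by simpa) (by simp; omega) (by simp; omega)
  have hyy := hE.dotProduct_M_mulVec_eval_eval hk (f := X ^ 2) (P := X ^ m) (Q := X ^ m)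
    (by simp; omega) (by simp; omega) (by simp; omega) (by simp; omega)
  simp only [dotProduct_M_mulVec, eval_pow, eval_X, eval_one, one_mul] at hzz hyz hyy
  have hexpand (s : Fin n) : ((m : ℝ) • z - ((m + 1) * E.node s) • y) ⬝ᵥ
      (E.Mbar s *ᵥ ((m : ℝ) • z - ((m + 1) * E.node s) • y)) =
      m ^ 2 * (z ⬝ᵥ (E.Mbar s *ᵥ z)) -
        2 * m * (m + 1) * (E.node s * (z ⬝ᵥ (E.Mbar s *ᵥ y))) +
        (m + 1) ^ 2 * (E.node s ^ 2 * (y ⬝ᵥ (E.Mbar s *ᵥ y))) := by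
    simp only [mulVec_sub, mulVec_smul, dotProduct_sub, sub_dotProduct, smul_dotProduct,
      dotProduct_smul, smul_eq_mul, hE.Mbar_comm hk s z y]
    ring
  simp only [hexpand, Finset.sum_add_distrib, Finset.sum_sub_distrib, ← Finset.mul_sum]
  rw [hzz, hyz, hyy]
  simp only [Finset.mul_sum, ← Finset.sum_add_distrib, ← Finset.sum_sub_distrib]
  refine Finset.sum_eq_zero fun s _ => ?_
  rcases m with _ | m
  · simp
  · simp only [derivative_X_pow, eval_mul, eval_C, eval_pow, eval_X, Nat.add_sub_cancel]
    push_cast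
    ring

theorem Mbar_mulVec_pow {m : ℕ} (hm : m ≤ p) (s : Fin n) :
    (E.Mbar s *ᵥ E.restrict fun x => x ^ m) =
      (m * E.node s ^ (m - 1)) • (E.Mbar s *ᵥ E.restrict fun x => x) := by
  induction m with
  | zero => simpa using hE.Mbar_mulVec_const hk 1 s
  | succ m ih =>
    rcases eq_or_ne m 0 with rfl | hm0
    · simp
    have h := hE.Mbar_mulVec_pow_succ hk hm s
    rw [ih (by omega), smul_smul] at h
    refine smul_right_injective _ (Nat.cast_ne_zero (R := ℝ).mpr hm0) (h.trans ?_)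
    obtain ⟨m, rfl⟩ := Nat.exists_eq_succ_of_ne_zero hm0
    simp only [smul_smul, Nat.succ_eq_add_one, Nat.add_sub_cancel]
    push_cast
    ring_nf

theorem Mbar_mulVec_eval {P : ℝ[X]} (hP : P.natDegree ≤ p) (s : Fin n) :
    (E.Mbar s *ᵥ E.restrict fun x => P.eval x) =
      P.derivative.eval (E.node s) • (E.Mbar s *ᵥ E.restrict fun x => x) := by
  refine induction_with_natDegree_le (motive := fun P : ℝ[X] =>
    (E.Mbar s *ᵥ E.restrict fun x => P.eval x) =
      P.derivative.eval (E.node s) • (E.Mbar s *ᵥ E.restrict fun x => x))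
    p (by simpa using hE.Mbar_mulVec_const hk 0 s) (fun m r _ hm => ?_)
    (fun P Q _ _ hP hQ => ?_) P hP
  · have hsmul : (E.restrict fun x => (C r * X ^ m).eval x) = r • E.restrict fun x => x ^ m := by
      ext i
      simp [restrict]
    rw [hsmul, mulVec_smul, hE.Mbar_mulVec_pow hk hm, smul_smul]
    simp [derivative_X_pow]
  · have hadd : (E.restrict fun x => (P + Q).eval x) =
        (E.restrict fun x => P.eval x) + E.restrict fun x => Q.eval x := by
      ext i
      simp [restrict]
    rw [hadd, mulVec_add, hP, hQ, derivative_add, eval_add, add_smul]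

theorem sum_eval_mul_Mbar {Q : ℝ[X]} (hQ : Q.natDegree + 1 ≤ 2 * p) :
    ∑ s, Q.eval (E.node s) *
        ((E.restrict fun x => x) ⬝ᵥ (E.Mbar s *ᵥ E.restrict fun x => x)) =
      ∑ s, E.w s * Q.eval (E.node s) := by
  refine induction_with_natDegree_le (motive := fun Q : ℝ[X] =>
    ∑ s, Q.eval (E.node s) *
        ((E.restrict fun x => x) ⬝ᵥ (E.Mbar s *ᵥ E.restrict fun x => x)) =
      ∑ s, E.w s * Q.eval (E.node s))
    (2 * p - 1) (by simp) (fun t r _ ht => ?_) (fun P Q _ _ hP hQ => ?_) Q (by omega)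
  · obtain ⟨l, j, hl, hj, rfl⟩ : ∃ l j, l + 1 ≤ p ∧ j ≤ p ∧ t = j + l :=
      ⟨min t (p - 1), t - min t (p - 1), by omega, by omega, by omega⟩
    have hl0 : (l + 1 : ℝ) ≠ 0 := by positivity
    have h := hE.dotProduct_M_mulVec_eval_eval hk (f := X ^ j) (P := X) (Q := X ^ (l + 1))
      (by simp; omega) (by simpa) (by simpa) (by simp; omega)
    simp only [dotProduct_M_mulVec, eval_X,
      hE.Mbar_comm hk _ _ (E.restrict fun x => eval x (X ^ _)),
      hE.Mbar_mulVec_eval hk ((natDegree_X_pow_le (R := ℝ) _).trans hl)] at h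
    refine mul_left_cancel₀ hl0 ((Finset.mul_sum _ _ _).trans ?_)
    convert congrArg (r * ·) h using 1
    all_goals
      simp only [derivative_X_pow, derivative_X, Finset.mul_sum, dotProduct_smul, smul_eq_mul,
        eval_mul, eval_C, eval_pow, eval_X, eval_one, Nat.cast_add_one,
        Nat.add_sub_cancel, pow_add _ j l]
      exact Finset.sum_congr rfl fun i _ => by ring
  · simp only [eval_add, add_mul, mul_add, Finset.sum_add_distrib, hP, hQ]

theorem formDefect_symm (f u v : Jet) : E.formDefect f u v = E.formDefect f v u := by
  simp only [formDefect, hE.M_comm hk _ (E.restrict u.1), mul_comm (u.2 _) (v.2 _),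
    add_comm (u.2 _ * _)]

theorem formDefect_C_left (f v : Jet) (r : ℝ) : E.formDefect f (.ofPoly (C r)) v = 0 := by
  have hR (γ : Side) := hE.extrapolation γ (C r) (by simp)
  simp only [eval_C] at hR
  simp [formDefect, Jet.ofPoly, dotProduct_M_mulVec, hE.Mbar_mulVec_const hk, hR]

theorem formDefect_ofPoly_of_le (hp : 1 ≤ p) {f u v : ℝ[X]} (hu : u.natDegree ≤ p)
    (hv : v.natDegree ≤ p) (hfuv : f.natDegree + u.natDegree + v.natDegree ≤ 2 * p + 1) :
    E.formDefect (.ofPoly f) (.ofPoly u) (.ofPoly v) = 0 := by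
  have hfu : (f * derivative u).natDegree ≤ 2 * p - v.natDegree :=
    natDegree_mul_derivative_le (by omega)
  have hq : (f * derivative u * derivative v).natDegree ≤ 2 * p - 1 :=
    natDegree_mul_derivative_le (by omega)
  have h := hE.sum_eval_mul_Mbar hk (Q := f * derivative u * derivative v) (by omega)
  simp only [formDefect, Jet.ofPoly, dotProduct_M_mulVec, hE.extrapolation _ _ hu,
    hE.extrapolation _ _ hv, hE.Mbar_mulVec_eval hk hu, dotProduct_smul,
    hE.Mbar_comm hk _ _ (E.restrict fun x => v.eval x), hE.Mbar_mulVec_eval hk hv]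
  simp only [eval_mul] at h
  simp only [smul_eq_mul, sub_self, mul_zero, add_zero, Finset.sum_const_zero, sub_zero,
    ← mul_assoc, sub_eq_zero] at h ⊢
  exact h

theorem formDefect_ofPoly_of_lt {f u v : ℝ[X]} (hu : p < u.natDegree)
    (hfuv : f.natDegree + u.natDegree + v.natDegree ≤ 2 * p + 1) :
    E.formDefect (.ofPoly f) (.ofPoly u) (.ofPoly v) = 0 := by
  have hfu : (f * u * derivative v).natDegree ≤ 2 * p :=
    natDegree_mul_derivative_le ((Nat.add_le_add_right natDegree_mul_le _).trans (by omega))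
  have hv : v.natDegree ≤ p := by omega
  have hnode : ∑ i, E.w i * u.eval (E.node i) * (derivative (f * derivative v)).eval (E.node i) +
      ∑ i, E.w i * (f.eval (E.node i) *
        (u.derivative.eval (E.node i) * v.derivative.eval (E.node i))) =
      ∑ i, E.w i * (derivative (f * u * derivative v)).eval (E.node i) := by
    rw [← Finset.sum_add_distrib]
    refine Finset.sum_congr rfl fun i _ => ?_
    simp only [derivative_mul, eval_add, eval_mul]
    ring
  have hend : ∑ γ : Side, γ.normal * ((E.R γ ⬝ᵥ E.restrict fun x => u.eval x) *
        (f * derivative v).eval (E.bdry γ)) -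
      ∑ γ : Side, γ.normal * (f.eval (E.bdry γ) * (v.derivative.eval (E.bdry γ) *
        ((E.R γ ⬝ᵥ E.restrict fun x => u.eval x) - u.eval (E.bdry γ)))) =
      ∑ γ : Side, γ.normal * (f * u * derivative v).eval (E.bdry γ) := by
    rw [← Finset.sum_sub_distrib]
    refine Finset.sum_congr rfl fun γ _ => ?_
    simp only [eval_mul]
    ring
  rw [hE.quadrature_eval hfu, ← hend] at hnode
  simp only [formDefect, Jet.ofPoly, hE.M_comm hk _ (E.restrict fun x => u.eval x),
    hE.dotProduct_M_mulVec_eval hk hv (f := f) (by omega), hE.extrapolation _ _ hv, restrict,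
    sub_self, mul_zero, zero_add] at hnode ⊢
  linarith

theorem formDefect_ofPoly (hp : 1 ≤ p) {f u v : ℝ[X]}
    (hfuv : f.natDegree + u.natDegree + v.natDegree ≤ 2 * p + 1) :
    E.formDefect (.ofPoly f) (.ofPoly u) (.ofPoly v) = 0 := by
  rcases lt_or_ge p u.natDegree with hu | hu
  · exact hE.formDefect_ofPoly_of_lt hk hu hfuv
  rcases lt_or_ge p v.natDegree with hv | hv
  · rw [hE.formDefect_symm hk]
    exact hE.formDefect_ofPoly_of_lt hk hv (by omega)
  · exact hE.formDefect_ofPoly_of_le hk hp hu hv hfuv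

theorem residualForm_ofPoly {f u : ℝ[X]} (hu : u.natDegree ≤ p)
    (hfu : f.natDegree + u.natDegree ≤ p + 1) (ε : Fin n → ℝ) :
    E.residualForm ε (.ofPoly f) (.ofPoly u) = 0 := by
  have hD : (E.D *ᵥ E.restrict ((fun x => f.eval x) * fun x => (derivative u).eval x)) =
      E.restrict fun x => (derivative (f * derivative u)).eval x := by
    simpa only [eval_mul (p := f), Pi.mul_def] using hE.accurate _ (natDegree_mul_derivative_le hfu)
  simp [residualForm, Jet.ofPoly, hE.dotProduct_M_mulVec_eval hk hu hfu, hD, restrict]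

end Exactness

end IsSBP

end SBPElement

/-! ### Estimates at the scale of an element -/

section Estimates

open Asymptotics Filter

theorem isBigO_dotProduct {α : Type*} {n : ℕ} {v q : α → Fin n → ℝ} {φ μ : α → ℝ}
    (hv : ∀ i, (fun x => v x i) =O[⊤] φ) (hq : ∀ i, (fun x => q x i) =O[⊤] μ) :
    (fun x => v x ⬝ᵥ q x) =O[⊤] fun x => φ x * μ x :=
  IsBigO.fun_sum fun i _ => (hv i).mul (hq i)

namespace SBPElement

variable {n p : ℕ}

theorem size_nonneg (E : SBPElement n) : 0 ≤ E.size :=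
  Metric.diam_nonneg

theorem norm_size (E : SBPElement n) : ‖E.size‖ = E.size :=
  Real.norm_of_nonneg E.size_nonneg

theorem abs_node_sub_le (E : SBPElement n) (i j : Fin n) : |E.node i - E.node j| ≤ E.size := by
  rw [← Real.dist_eq]
  exact Metric.dist_le_diam_of_mem (Set.finite_range E.node).isBounded (Set.mem_range_self i)
    (Set.mem_range_self j)

theorem sum_R_mul_node_sub {E : SBPElement n} (hE : E.IsSBP p) (hp : 1 ≤ p) (γ : Side) (y : ℝ) :
    ∑ i, E.R γ i * (E.node i - y) = E.bdry γ - y := by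
  have h := hE.extrapolation γ (X - C y) (by simpa using hp)
  simp only [eval_sub, eval_X, eval_C] at h
  exact h

theorem size_pos {E : SBPElement n} (hE : E.IsSBP p) (hp : 1 ≤ p) : 0 < E.size := by
  by_contra! hsize
  have hR (y : ℝ) := sum_R_mul_node_sub hE hp Side.left y
  obtain ⟨i⟩ : Nonempty (Fin n) := by
    by_contra! hn
    linarith [hR 0, hR 1, Fintype.sum_empty fun i => E.R Side.left i * (E.node i - 0),
      Fintype.sum_empty fun i => E.R Side.left i * (E.node i - 1)]
  have hnode (j : Fin n) : E.node j = E.node i :=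
    sub_eq_zero.mp (abs_nonpos_iff.mp ((E.abs_node_sub_le j i).trans hsize))
  have hD := congrFun (hE.accurate (X - C (E.node i)) (by simpa using hp)) i
  simp [mulVec, dotProduct, restrict, hnode] at hD

/-- The error of `R_γ Λ D_b` as an approximation of the flux `f u'` at the end `γ`. -/
def fluxError (E : SBPElement n) (γ : Side) (f u : Jet) : ℝ :=
  ∑ i, E.R γ i * (f.1 (E.node i) * (E.Db *ᵥ E.restrict u.1) i) - f.1 (E.bdry γ) * u.2 (E.bdry γ)

section Linearity

variable (E : SBPElement n)

theorem restrict_add (f g : ℝ → ℝ) : E.restrict (f + g) = E.restrict f + E.restrict g := rfl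

theorem restrict_smul (r : ℝ) (f : ℝ → ℝ) : E.restrict (r • f) = r • E.restrict f := rfl

theorem M_add (f g : ℝ → ℝ) : E.M (f + g) = E.M f + E.M g := by
  simp only [M, Pi.add_apply, add_smul, Finset.sum_add_distrib]

theorem M_smul (r : ℝ) (f : ℝ → ℝ) : E.M (r • f) = r • E.M f := by
  simp only [M, Pi.smul_apply, smul_assoc, Finset.smul_sum]

theorem isLinearMap_fluxError_left (γ : Side) (u : Jet) :
    IsLinearMap ℝ fun f => E.fluxError γ f u where
  map_add f g := by
    simp only [fluxError, Prod.fst_add, Pi.add_apply, add_mul, mul_add, Finset.sum_add_distrib]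
    ring
  map_smul r f := by
    simp only [fluxError, Prod.smul_fst, Pi.smul_apply, smul_eq_mul, mul_assoc,
      mul_left_comm _ r, ← Finset.mul_sum, mul_sub]

theorem isLinearMap_fluxError_right (γ : Side) (f : Jet) :
    IsLinearMap ℝ (E.fluxError γ f) where
  map_add u v := by
    simp only [fluxError, Prod.fst_add, Prod.snd_add, restrict_add, mulVec_add, Pi.add_apply,
      mul_add, Finset.sum_add_distrib]
    ring
  map_smul r u := by
    simp only [fluxError, Prod.smul_fst, Prod.smul_snd, restrict_smul, mulVec_smul, Pi.smul_apply,
      smul_eq_mul, mul_left_comm _ r, ← Finset.mul_sum, mul_sub]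

theorem isLinearMap_residualForm_left (ε : Fin n → ℝ) (u : Jet) :
    IsLinearMap ℝ fun f => E.residualForm ε f u where
  map_add f g := by
    simp only [residualForm, Prod.fst_add, Pi.add_apply, M_add, add_mulVec, dotProduct_add,
      restrict_add, mulVec_add, add_mul, mul_add, Finset.sum_add_distrib]
    ring
  map_smul r f := by
    simp only [residualForm, Prod.smul_fst, Pi.smul_apply, M_smul, smul_mulVec, dotProduct_smul,
      smul_mul_assoc, restrict_smul, mulVec_smul, smul_eq_mul, mul_assoc, mul_left_comm _ r,
      ← Finset.mul_sum, mul_sub, mul_add]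

theorem isLinearMap_residualForm_right (ε : Fin n → ℝ) (f : Jet) :
    IsLinearMap ℝ (E.residualForm ε f) where
  map_add u v := by
    simp only [residualForm, Prod.fst_add, Prod.snd_add, Pi.add_apply, restrict_add, mulVec_add,
      dotProduct_add, mul_add, Finset.sum_add_distrib]
    ring
  map_smul r u := by
    simp only [residualForm, Prod.smul_fst, Prod.smul_snd, Pi.smul_apply, restrict_smul,
      mulVec_smul, dotProduct_smul, mul_smul_comm, smul_eq_mul, mul_left_comm _ r,
      ← Finset.mul_sum, mul_sub, mul_add]

theorem isLinearMap_formDefect_left (u v : Jet) : IsLinearMap ℝ fun f => E.formDefect f u v where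
  map_add f g := by
    simp only [formDefect, Prod.fst_add, Pi.add_apply, M_add, add_mulVec, dotProduct_add, add_mul,
      mul_add, Finset.sum_add_distrib]
    ring
  map_smul r f := by
    simp only [formDefect, Prod.smul_fst, Pi.smul_apply, M_smul, smul_mulVec, dotProduct_smul,
      smul_eq_mul, mul_assoc, mul_left_comm _ r, ← Finset.mul_sum, ← mul_sub]

theorem isLinearMap_formDefect_middle (f v : Jet) :
    IsLinearMap ℝ fun u => E.formDefect f u v where
  map_add u u' := by
    simp only [formDefect, restrict_add, mulVec_add, dotProduct_add, Prod.fst_add, Prod.snd_add,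
      Pi.add_apply, add_mul, mul_add, mul_sub, Finset.sum_add_distrib, Finset.sum_sub_distrib]
    ring
  map_smul r u := by
    simp only [formDefect, restrict_smul, mulVec_smul, dotProduct_smul, Prod.smul_fst,
      Prod.smul_snd, Pi.smul_apply, smul_eq_mul, mul_assoc, mul_left_comm _ r, ← Finset.mul_sum,
      ← mul_sub, ← mul_add]

end Linearity

/-- A family of elements in `[a, b]` whose operators scale with the element size, uniformly over
the family. -/
structure IsRegularFamily {α : Type*} (a b : ℝ) (p : ℕ) (E : α → SBPElement n) : Prop where
  isSBP x : (E x).IsSBP p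
  kind x : (E x).IsNarrow p ∨ (E x).IsWide
  node_mem x i : (E x).node i ∈ Icc a b
  bdry_mem x γ : (E x).bdry γ ∈ Icc a b
  R_isBigO γ i : (fun x => (E x).R γ i) =O[⊤] fun _ => (1 : ℝ)
  w_isBigO i : (fun x => (E x).w i) =O[⊤] fun x => (E x).size
  D_isBigO i j : (fun x => (E x).size * (E x).D i j) =O[⊤] fun _ => (1 : ℝ)
  Db_isBigO i j : (fun x => (E x).size * (E x).Db i j) =O[⊤] fun _ => (1 : ℝ)
  Mbar_isBigO l i j : (fun x => (E x).size * (E x).Mbar l i j) =O[⊤] fun _ => (1 : ℝ)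

/-- The size of the jets `f x` near the element `E x`, at the scale of the element. -/
abbrev JetIsBigO {α : Type*} (a b : ℝ) (E : α → SBPElement n) (f : α → Jet) (g : α → ℝ) : Prop :=
  Jet.IsBigOAt a b (fun x => (E x).bdry Side.left) (fun x => (E x).size) f g

namespace IsRegularFamily

variable {α : Type*} {a b : ℝ} {E : α → SBPElement n} (h : IsRegularFamily a b p E) (hp : 1 ≤ p)

section Geometry

include h

theorem size_isBigO_one : (fun x => (E x).size) =O[⊤] fun _ => (1 : ℝ) :=
  isBigO_top.mpr ⟨Metric.diam (Icc a b), fun x => by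
    rw [norm_one, mul_one, norm_size]
    exact Metric.diam_mono (range_subset_iff.mpr (h.node_mem x)) (Metric.isBounded_Icc a b)⟩

theorem size_pow_isBigO {m k : ℕ} (hmk : m ≤ k) :
    (fun x => (E x).size ^ k) =O[⊤] fun x => (E x).size ^ m := by
  obtain ⟨r, rfl⟩ := Nat.exists_eq_add_of_le hmk
  simpa [pow_add] using (isBigO_refl (fun x => (E x).size ^ m) ⊤).mul (h.size_isBigO_one.pow r)

include hp

theorem isBigO_of_size_mul {e ν : α → ℝ} {m k : ℕ} (hmk : m + 1 ≤ k)
    (he : (fun x => (E x).size * e x) =O[⊤] fun x => ν x * (E x).size ^ k) :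
    e =O[⊤] fun x => ν x * (E x).size ^ m := by
  have hpos x := (size_pos (h.isSBP x) hp).ne'
  refine ((isBigO_refl (fun x => (E x).size⁻¹) ⊤).mul
    (he.trans ((isBigO_refl ν ⊤).mul (h.size_pow_isBigO hmk)))).congr (fun x => ?_) fun x => ?_
  · rw [inv_mul_cancel_left₀ (hpos x)]
  · rw [pow_succ', mul_left_comm, inv_mul_cancel_left₀ (hpos x)]

theorem bdry_sub_node_isBigO (γ : Side) (i : Fin n) :
    (fun x => (E x).bdry γ - (E x).node i) =O[⊤] fun x => (E x).size := by
  have hnode (j : Fin n) : (fun x => (E x).node j - (E x).node i) =O[⊤] fun x => (E x).size :=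
    isBigO_of_le _ fun x => ((E x).abs_node_sub_le j i).trans (le_abs_self _)
  simpa [dotProduct, fun x => sum_R_mul_node_sub (h.isSBP x) hp] using
    isBigO_dotProduct (h.R_isBigO γ) hnode

theorem node_sub_isBigO (i : Fin n) :
    (fun x => (E x).node i - (E x).bdry Side.left) =O[⊤] fun x => (E x).size :=
  (h.bdry_sub_node_isBigO hp Side.left i).neg_left.congr_left fun _ => neg_sub _ _

theorem bdry_sub_isBigO (γ : Side) :
    (fun x => (E x).bdry γ - (E x).bdry Side.left) =O[⊤] fun x => (E x).size := by
  simpa [dotProduct, fun x => sum_R_mul_node_sub (h.isSBP x) hp] using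
    isBigO_dotProduct (h.R_isBigO γ) (h.node_sub_isBigO hp)

theorem restrict_isBigO {f : α → Jet} {φ : α → ℝ} (hf : JetIsBigO a b E f φ) (i : Fin n) :
    (fun x => (E x).restrict (f x).1 i) =O[⊤] φ :=
  hf.fst (h.node_mem · i) (h.node_sub_isBigO hp i)

theorem fst_bdry {f : α → Jet} {φ : α → ℝ} (hf : JetIsBigO a b E f φ) (γ : Side) :
    (fun x => (f x).1 ((E x).bdry γ)) =O[⊤] φ :=
  hf.fst (h.bdry_mem · γ) (h.bdry_sub_isBigO hp γ)

theorem snd_node {f : α → Jet} {φ : α → ℝ} (hf : JetIsBigO a b E f φ) (i : Fin n) :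
    (fun x => (E x).size * (f x).2 ((E x).node i)) =O[⊤] φ :=
  hf.snd (h.node_mem · i) (h.node_sub_isBigO hp i)

theorem snd_bdry {f : α → Jet} {φ : α → ℝ} (hf : JetIsBigO a b E f φ) (γ : Side) :
    (fun x => (E x).size * (f x).2 ((E x).bdry γ)) =O[⊤] φ :=
  hf.snd (h.bdry_mem · γ) (h.bdry_sub_isBigO hp γ)

theorem w_mul_snd_node {f : α → Jet} {φ : α → ℝ} (hf : JetIsBigO a b E f φ) (i : Fin n) :
    (fun x => (E x).w i * (f x).2 ((E x).node i)) =O[⊤] φ :=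
  ((h.w_isBigO i).mul (isBigO_refl _ ⊤)).trans (h.snd_node hp hf i)

end Geometry

section Bounds

theorem size_mul_mulVec_isBigO {A : α → Matrix (Fin n) (Fin n) ℝ} {v : α → Fin n → ℝ} {μ : α → ℝ}
    (hA : ∀ i j, (fun x => (E x).size * A x i j) =O[⊤] fun _ => (1 : ℝ))
    (hv : ∀ i, (fun x => v x i) =O[⊤] μ) (i : Fin n) :
    (fun x => (E x).size * (A x *ᵥ v x) i) =O[⊤] μ := by
  simpa [mulVec, dotProduct, Finset.mul_sum, mul_assoc] using isBigO_dotProduct (hA i) hv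

include h

theorem R_dotProduct_isBigO {v : α → Fin n → ℝ} {μ : α → ℝ} (hv : ∀ i, (fun x => v x i) =O[⊤] μ)
    (γ : Side) : (fun x => (E x).R γ ⬝ᵥ v x) =O[⊤] μ := by
  simpa using isBigO_dotProduct (h.R_isBigO γ) hv

theorem size_mul_Dn_dotProduct_isBigO {lam : ℝ → ℝ} (hlam : ContinuousOn lam (Icc a b))
    {v : α → Fin n → ℝ} {μ : α → ℝ} (hv : ∀ i, (fun x => v x i) =O[⊤] μ) (γ : Side) :
    (fun x => (E x).size * ((E x).Dn lam γ ⬝ᵥ v x)) =O[⊤] μ := by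
  have hterm (i : Fin n) : (fun x => lam ((E x).node i) * ((E x).size * ((E x).Db *ᵥ v x) i))
      =O[⊤] μ := by
    simpa using (isBigO_one_of_continuousOn hlam (h.node_mem · i)).mul
      (size_mul_mulVec_isBigO h.Db_isBigO hv i)
  refine ((h.R_dotProduct_isBigO hterm γ).const_mul_left γ.normal).congr_left fun x => ?_
  rw [Dn_dotProduct]
  simp only [dotProduct, Finset.mul_sum]
  exact Finset.sum_congr rfl fun i _ => by ring

theorem size_mul_M_isBigO {f : α → ℝ → ℝ} {u v : α → Fin n → ℝ} {φ χ ω : α → ℝ}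
    (hf : ∀ i, (fun x => (E x).restrict (f x) i) =O[⊤] φ) (hu : ∀ i, (fun x => u x i) =O[⊤] χ)
    (hv : ∀ i, (fun x => v x i) =O[⊤] ω) :
    (fun x => (E x).size * (v x ⬝ᵥ ((E x).M (f x) *ᵥ u x))) =O[⊤] fun x => φ x * χ x * ω x := by
  have hterm (l : Fin n) := (hf l).mul
    (isBigO_dotProduct hv (size_mul_mulVec_isBigO (h.Mbar_isBigO l) hu))
  refine (IsBigO.fun_sum fun l (_ : l ∈ Finset.univ) => hterm l).congr (fun x => ?_)
    fun x => by ring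
  rw [dotProduct_M_mulVec]
  simp only [dotProduct, Finset.mul_sum, restrict]
  exact Finset.sum_congr rfl fun l _ => Finset.sum_congr rfl fun i _ => by ring

include hp

theorem size_mul_fluxError_isBigO {f u : α → Jet} {φ χ : α → ℝ} (hf : JetIsBigO a b E f φ)
    (hu : JetIsBigO a b E u χ) (γ : Side) :
    (fun x => (E x).size * (E x).fluxError γ (f x) (u x)) =O[⊤] fun x => φ x * χ x := by
  have hterm (i : Fin n) := (h.restrict_isBigO hp hf i).mul
    (size_mul_mulVec_isBigO h.Db_isBigO (h.restrict_isBigO hp hu) i)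
  refine ((h.R_dotProduct_isBigO hterm γ).sub
    ((h.fst_bdry hp hf γ).mul (h.snd_bdry hp hu γ))).congr_left fun x => ?_
  simp only [fluxError, restrict, dotProduct, mul_sub, Finset.mul_sum]
  exact congrArg₂ _ (Finset.sum_congr rfl fun i _ => by ring) (by ring)

theorem size_mul_residualForm_isBigO {f u : α → Jet} {φ χ ν : α → ℝ} {ε : α → Fin n → ℝ}
    (hf : JetIsBigO a b E f φ) (hu : JetIsBigO a b E u χ) (hε : ∀ i, (fun x => ε x i) =O[⊤] ν) :
    (fun x => (E x).size * (E x).residualForm (ε x) (f x) (u x)) =O[⊤]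
      fun x => φ x * χ x * ν x := by
  have hM := h.size_mul_M_isBigO (h.restrict_isBigO hp hf) (h.restrict_isBigO hp hu) hε
  have hend (γ : Side) := (((h.fst_bdry hp hf γ).mul (h.snd_bdry hp hu γ)).mul
    (h.R_dotProduct_isBigO hε γ)).const_mul_left γ.normal
  have hfu (j : Fin n) : (fun x => ((E x).size • (E x).restrict ((f x).1 * (u x).2)) j)
      =O[⊤] fun x => φ x * χ x :=
    ((h.restrict_isBigO hp hf j).mul (h.snd_node hp hu j)).congr_left fun x =>
      mul_left_comm _ _ _
  have hnode (i : Fin n) := (((h.w_isBigO i).mul (isBigO_refl _ ⊤)).trans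
    (size_mul_mulVec_isBigO h.D_isBigO hfu i)).mul (hε i)
  refine ((hM.sub (IsBigO.fun_sum fun γ (_ : γ ∈ Finset.univ) => hend γ)).add
    (IsBigO.fun_sum fun i (_ : i ∈ Finset.univ) => hnode i)).congr_left fun x => ?_
  simp only [residualForm, mul_add, mul_sub, Finset.mul_sum, mulVec_smul, Pi.smul_apply,
    smul_eq_mul]
  congr 1
  · exact congrArg _ (Finset.sum_congr rfl fun γ _ => by ring)
  · exact Finset.sum_congr rfl fun i _ => by ring

theorem size_mul_formDefect_isBigO {f u v : α → Jet} {φ χ ω : α → ℝ} (hf : JetIsBigO a b E f φ)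
    (hu : JetIsBigO a b E u χ) (hv : JetIsBigO a b E v ω) :
    (fun x => (E x).size * (E x).formDefect (f x) (u x) (v x)) =O[⊤]
      fun x => φ x * χ x * ω x := by
  have hM := h.size_mul_M_isBigO (h.restrict_isBigO hp hf) (h.restrict_isBigO hp hu)
    (h.restrict_isBigO hp hv)
  have hnode (i : Fin n) := ((h.restrict_isBigO hp hf i).mul (h.w_mul_snd_node hp hu i)).mul
    (h.snd_node hp hv i)
  have hextr {u : α → Jet} {χ : α → ℝ} (hu : JetIsBigO a b E u χ) (γ : Side) :=
    (h.R_dotProduct_isBigO (h.restrict_isBigO hp hu) γ).sub (h.fst_bdry hp hu γ)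
  have hend (γ : Side) := ((((h.fst_bdry hp hf γ).mul (h.snd_bdry hp hu γ)).mul (hextr hv γ)).add
    (((h.fst_bdry hp hf γ).mul (hextr hu γ)).mul (h.snd_bdry hp hv γ))).const_mul_left γ.normal
  refine ((hM.sub (IsBigO.fun_sum fun i (_ : i ∈ Finset.univ) => hnode i)).sub
    (IsBigO.fun_sum fun γ (_ : γ ∈ Finset.univ) => hend γ)).congr_left fun x => ?_
  simp only [formDefect, mul_sub, Finset.mul_sum]
  congr 1
  · exact congrArg _ (Finset.sum_congr rfl fun i _ => by simp only [restrict]; ring)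
  · exact Finset.sum_congr rfl fun γ _ => by ring

end Bounds

end IsRegularFamily

end SBPElement

end Estimates

section ConsistencyErrors

open Asymptotics Filter

variable {n p : ℕ} {a b : ℝ}

theorem contDiffOn_flux {r : ℕ} (hab : a < b) {lam V : ℝ → ℝ} (hlam : ContDiffOn ℝ r lam (Icc a b))
    (hV : ContDiffOn ℝ ((r + 1 : ℕ) : WithTop ℕ∞) V (Icc a b)) :
    ContDiffOn ℝ r (flux a b lam V) (Icc a b) :=
  hlam.mul (hV.derivWithin (uniqueDiffOn_Icc hab) (by norm_cast))

/-- The error of the quadrature rule with weights `w` for the integral of `V'` over the element. -/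
def SBPElement.quadratureError (E : SBPElement n) (a b : ℝ) (V : ℝ → ℝ) : ℝ :=
  ∑ i, E.w i * derivWithin V (Icc a b) (E.node i) - ∑ γ : Side, γ.normal * V (E.bdry γ)

/-- The consistency error of the interior operator, tested with `ε`: the defect of summation by
parts with the exact flux at the ends and its exact derivative at the nodes. -/
def SBPElement.weakResidual (E : SBPElement n) (a b : ℝ) (lam U : ℝ → ℝ) (ε : Fin n → ℝ) : ℝ :=
  ε ⬝ᵥ (E.M lam *ᵥ E.restrict U) -
    ∑ γ : Side, γ.normal * ((E.R γ ⬝ᵥ ε) * flux a b lam U (E.bdry γ)) +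
    ∑ i, E.w i * ε i * derivWithin (flux a b lam U) (Icc a b) (E.node i)

namespace SBPElement.IsRegularFamily

variable {α : Type*} {E : α → SBPElement n} (h : IsRegularFamily a b p E)
  (hp : 1 ≤ p) (hab : a < b)

include h hp

theorem isBigO_of_size_mul_one {e : α → ℝ} {m k : ℕ} (hmk : m + 1 ≤ k)
    (he : (fun x => (E x).size * e x) =O[⊤] fun x => (E x).size ^ k) :
    e =O[⊤] fun x => (E x).size ^ m := by
  simpa using h.isBigO_of_size_mul hp (ν := fun _ => 1) hmk (by simpa using he)

include hab

theorem fluxError_isBigO {f V : ℝ → ℝ} (hf : ContDiffOn ℝ p f (Icc a b))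
    (hV : ContDiffOn ℝ ((p + 1 : ℕ) : WithTop ℕ∞) V (Icc a b)) (γ : Side) :
    (fun x => (E x).fluxError γ (.of a b f) (.of a b V)) =O[⊤] fun x => (E x).size ^ p := by
  refine Jet.isBigO_apply_of_of hab (by omega) hf hV (h.bdry_mem · Side.left) h.size_isBigO_one
    (fun x => (E x).isLinearMap_fluxError_left γ) (fun x => (E x).isLinearMap_fluxError_right γ)
    (fun x f => ?_) (fun i j hij => ?_) fun f u i j hij hf hu => ?_
  · have hDb := (h.isSBP x).R_mul_Db_eval (h.kind x) (P := 1) (by simp) γ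
    simp only [fluxError, Jet.mono, Jet.ofPoly, pow_zero, mul_left_comm _ (f.1 _), hDb]
    simp
  · refine (isBigO_zero _ _).congr_left fun x => ?_
    have hflux := (h.isSBP x).sum_R_mul_Db_eval (h.kind x)
      (f := (X - C ((E x).bdry Side.left)) ^ i) (P := (X - C ((E x).bdry Side.left)) ^ j)
      (by simp; omega) (by simp; omega) γ
    simp only [fluxError, Jet.mono, Jet.ofPoly, hflux, eval_mul, sub_self]
  · exact h.isBigO_of_size_mul_one hp hij
      (by simpa [pow_add] using h.size_mul_fluxError_isBigO hp hf hu γ)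

theorem residualForm_isBigO {f V : ℝ → ℝ} (hf : ContDiffOn ℝ p f (Icc a b))
    (hV : ContDiffOn ℝ ((p + 1 : ℕ) : WithTop ℕ∞) V (Icc a b)) {ε : α → Fin n → ℝ} {ν : α → ℝ}
    (hε : ∀ i, (fun x => ε x i) =O[⊤] ν) :
    (fun x => (E x).residualForm (ε x) (.of a b f) (.of a b V)) =O[⊤]
      fun x => ν x * (E x).size ^ p := by
  refine Jet.isBigO_apply_of_of hab (by omega) hf hV (h.bdry_mem · Side.left) h.size_isBigO_one
    (fun x => (E x).isLinearMap_residualForm_left (ε x))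
    (fun x => (E x).isLinearMap_residualForm_right (ε x))
    (fun x f => ?_) (fun i j hij => ?_) fun f u i j hij hf hu => ?_
  · have hM := (h.isSBP x).Mbar_mulVec_const (h.kind x) 1
    have hz : (E x).restrict (f.1 * fun _ => 0) = 0 := funext fun _ => mul_zero _
    simp [residualForm, Jet.mono, Jet.ofPoly, dotProduct_M_mulVec, hM, hz]
  · refine (isBigO_zero _ _).congr_left fun x => Eq.symm ?_
    exact (h.isSBP x).residualForm_ofPoly (h.kind x) (by simp; omega) (by simp; omega) (ε x)
  · exact h.isBigO_of_size_mul hp hij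
      ((h.size_mul_residualForm_isBigO hp hf hu hε).congr_right fun x => by ring)

theorem formDefect_isBigO {f U V : ℝ → ℝ}
    (hf : ContDiffOn ℝ ((2 * p + 1 : ℕ) : WithTop ℕ∞) f (Icc a b))
    (hU : ContDiffOn ℝ ((2 * p + 2 : ℕ) : WithTop ℕ∞) U (Icc a b))
    (hV : ContDiffOn ℝ ((2 * p + 2 : ℕ) : WithTop ℕ∞) V (Icc a b)) :
    (fun x => (E x).formDefect (.of a b f) (.of a b U) (.of a b V)) =O[⊤]
      fun x => (E x).size ^ (2 * p + 1) := by
  have hone {m : ℕ} {W : ℝ → ℝ} (hm : 1 ≤ m) (hW : ContDiffOn ℝ m W (Icc a b)) :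
      JetIsBigO a b E (fun _ => .of a b W) fun _ => 1 :=
    Jet.isBigO_of_one hab (hW.of_le (by exact_mod_cast hm)) h.size_isBigO_one
  have hsmall {f u v : α → Jet} {i j k : ℕ} (hijk : 2 * p + 2 ≤ i + j + k)
      (hf : JetIsBigO a b E f fun x => (E x).size ^ i)
      (hu : JetIsBigO a b E u fun x => (E x).size ^ j)
      (hv : JetIsBigO a b E v fun x => (E x).size ^ k) :
      (fun x => (E x).formDefect (f x) (u x) (v x)) =O[⊤] fun x => (E x).size ^ (2 * p + 1) := by
    exact h.isBigO_of_size_mul_one hp (k := i + j + k) hijk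
      (by simpa [pow_add] using h.size_mul_formDefect_isBigO hp hf hu hv)
  have hmono (i : ℕ) := Jet.isBigO_mono a b (fun x => (E x).bdry Side.left) (fun x => (E x).size) i
  refine IsBigO.congr_left ?_ fun x => (h.isSBP x).formDefect_symm (h.kind x) _ (.of a b V) _
  refine Jet.isBigO_apply_of hab (by omega) hU (h.bdry_mem · Side.left) (fun x => ?_)
    (fun k _ => ?_) fun u hu => hsmall (i := 0) (j := 0) (by omega)
      (by simpa using hone (by omega) hf) (by simpa using hone (by omega) hV) hu
  · rw [funext ((h.isSBP x).formDefect_symm (h.kind x) (.of a b f) (.of a b V))]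
    exact (E x).isLinearMap_formDefect_middle _ _
  refine Jet.isBigO_apply_of_of hab (by omega) hf hV (h.bdry_mem · Side.left) h.size_isBigO_one
    (fun x v => (E x).isLinearMap_formDefect_left v _)
    (fun x f => (E x).isLinearMap_formDefect_middle f _)
    (fun x f => ?_) (fun i j _ => ?_) fun f v i j hij hf hv => hsmall (by omega) hf hv (hmono k)
  · simpa [Jet.mono] using (h.isSBP x).formDefect_C_left (h.kind x) f (Jet.mono _ k) 1
  by_cases hijk : i + j + k ≤ 2 * p + 1
  · refine (isBigO_zero _ _).congr_left fun x => Eq.symm ?_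
    exact (h.isSBP x).formDefect_ofPoly (h.kind x) hp (by simpa using hijk)
  · exact hsmall (by omega) (hmono i) (hmono j) (hmono k)

theorem extrapolation_isBigO {V : ℝ → ℝ}
    (hV : ContDiffOn ℝ ((p + 1 : ℕ) : WithTop ℕ∞) V (Icc a b)) (γ : Side) :
    (fun x => (E x).R γ ⬝ᵥ (E x).restrict V - V ((E x).bdry γ)) =O[⊤]
      fun x => (E x).size ^ (p + 1) := by
  refine Jet.isBigO_apply_of hab p.succ_ne_zero hV (h.bdry_mem · Side.left)
    (L := fun x u => (E x).R γ ⬝ᵥ (E x).restrict u.1 - u.1 ((E x).bdry γ))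
    (fun x => ⟨fun u v => ?_, fun r u => ?_⟩) (fun i hi => ?_)
    fun u hu => (h.R_dotProduct_isBigO (h.restrict_isBigO hp hu) γ).sub (h.fst_bdry hp hu γ)
  · simp only [Prod.fst_add, restrict_add, dotProduct_add, Pi.add_apply]
    ring
  · simp only [Prod.smul_fst, restrict_smul, dotProduct_smul, Pi.smul_apply, smul_sub]
  · refine (isBigO_zero _ _).congr_left fun x => Eq.symm (sub_eq_zero.mpr ?_)
    exact (h.isSBP x).extrapolation γ _ (by simp; omega)

theorem derivative_isBigO {V : ℝ → ℝ}
    (hV : ContDiffOn ℝ ((p + 1 : ℕ) : WithTop ℕ∞) V (Icc a b)) (i : Fin n) :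
    (fun x => ((E x).D *ᵥ (E x).restrict V) i - derivWithin V (Icc a b) ((E x).node i)) =O[⊤]
      fun x => (E x).size ^ p := by
  refine Jet.isBigO_apply_of hab p.succ_ne_zero hV (h.bdry_mem · Side.left)
    (ρ := fun x => (E x).size)
    (L := fun x u => ((E x).D *ᵥ (E x).restrict u.1) i - u.2 ((E x).node i))
    (fun x => ⟨fun u v => ?_, fun r u => ?_⟩) (fun j hj => ?_) fun u hu => ?_
  · simp only [Prod.fst_add, Prod.snd_add, restrict_add, mulVec_add, Pi.add_apply]
    ring
  · simp only [Prod.smul_fst, Prod.smul_snd, restrict_smul, mulVec_smul, Pi.smul_apply, smul_sub]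
  · refine (isBigO_zero _ _).congr_left fun x => Eq.symm (sub_eq_zero.mpr ?_)
    exact congrFun ((h.isSBP x).accurate _ (by simp; omega)) i
  · refine h.isBigO_of_size_mul_one hp le_rfl ?_
    simpa only [mul_sub] using (size_mul_mulVec_isBigO h.D_isBigO (h.restrict_isBigO hp hu) i).sub
      (h.snd_node hp hu i)

theorem quadratureError_isBigO {V : ℝ → ℝ}
    (hV : ContDiffOn ℝ ((2 * p + 1 : ℕ) : WithTop ℕ∞) V (Icc a b)) :
    (fun x => (E x).quadratureError a b V) =O[⊤] fun x => (E x).size ^ (2 * p + 1) := by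
  refine Jet.isBigO_apply_of hab (2 * p).succ_ne_zero hV (h.bdry_mem · Side.left)
    (L := fun x u => ∑ i, (E x).w i * u.2 ((E x).node i) -
      ∑ γ : Side, γ.normal * u.1 ((E x).bdry γ))
    (fun x => ⟨fun u v => ?_, fun r u => ?_⟩) (fun j hj => ?_)
    fun u hu => (IsBigO.fun_sum fun i _ => h.w_mul_snd_node hp hu i).sub
      (IsBigO.fun_sum fun γ _ => (h.fst_bdry hp hu γ).const_mul_left _)
  · simp only [Prod.fst_add, Prod.snd_add, Pi.add_apply, mul_add, Finset.sum_add_distrib]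
    ring
  · simp only [Prod.smul_fst, Prod.smul_snd, Pi.smul_apply, smul_eq_mul, mul_left_comm _ r,
      ← Finset.mul_sum, mul_sub]
  · refine (isBigO_zero _ _).congr_left fun x => Eq.symm (sub_eq_zero.mpr ?_)
    exact (h.isSBP x).quadrature_eval (by simp; omega)

theorem weakResidual_isBigO {lam U : ℝ → ℝ}
    (hlam : ContDiffOn ℝ ((p + 1 : ℕ) : WithTop ℕ∞) lam (Icc a b))
    (hU : ContDiffOn ℝ ((p + 2 : ℕ) : WithTop ℕ∞) U (Icc a b)) {ε : α → Fin n → ℝ} {ν : α → ℝ}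
    (hε : ∀ i, (fun x => ε x i) =O[⊤] ν) :
    (fun x => (E x).weakResidual a b lam U (ε x)) =O[⊤] fun x => ν x * (E x).size ^ p := by
  have hform := h.residualForm_isBigO hp hab (hlam.of_le (by norm_cast; omega))
    (hU.of_le (by norm_cast; omega)) hε
  have hnode (i : Fin n) := (((h.w_isBigO i).trans h.size_isBigO_one).mul (hε i)).mul
    (h.derivative_isBigO hp hab (contDiffOn_flux hab hlam hU) i)
  refine (hform.sub ((IsBigO.fun_sum fun i (_ : i ∈ Finset.univ) => hnode i).congr_right
    fun x => by rw [one_mul])).congr_left fun x => ?_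
  have hflux : (E x).residualForm (ε x) (.of a b lam) (.of a b U) =
      ε x ⬝ᵥ ((E x).M lam *ᵥ (E x).restrict U) -
        ∑ γ : Side, γ.normal * (((E x).R γ ⬝ᵥ ε x) * flux a b lam U ((E x).bdry γ)) +
        ∑ i, (E x).w i * ε x i * ((E x).D *ᵥ (E x).restrict (flux a b lam U)) i := rfl
  rw [hflux, weakResidual]
  simp only [mul_sub, Finset.sum_sub_distrib]
  ring

end SBPElement.IsRegularFamily

end ConsistencyErrors

/-! ### Meshes, weak forms and duality -/

namespace Side

@[simp] theorem opp_opp (γ : Side) : γ.opp.opp = γ := by cases γ <;> rfl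

@[simp] theorem normal_opp (γ : Side) : γ.opp.normal = -γ.normal := by
  cases γ <;> simp [opp, normal]

theorem opp_ne (γ : Side) : γ.opp ≠ γ := by cases γ <;> simp [opp]

theorem sum_normal_mul (f : Side → ℝ) : ∑ γ : Side, γ.normal * f γ = f right - f left := by
  have huniv : (Finset.univ : Finset Side) = {left, right} := rfl
  rw [huniv, Finset.sum_pair (by decide)]
  simp only [normal]
  ring

end Side

namespace Discretization

variable {n p : ℕ} {a b C : ℝ} {d : Discretization n} {bc : Side → BC} {lam : ℝ → ℝ}

section Mesh

theorem nbr_left (k : Fin d.ne) : d.nbr Side.left k =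
    if 0 < (k : ℕ) then some ⟨(k : ℕ) - 1, lt_of_le_of_lt (Nat.sub_le _ _) k.isLt⟩ else none :=
  rfl

theorem nbr_right (k : Fin d.ne) : d.nbr Side.right k =
    if h : (k : ℕ) + 1 < d.ne then some ⟨(k : ℕ) + 1, h⟩ else none :=
  rfl

theorem nbr_opp {γ : Side} {k m : Fin d.ne} (hm : d.nbr γ k = some m) :
    d.nbr γ.opp m = some k := by
  cases γ
  · rw [nbr_left] at hm
    split_ifs at hm with hk
    simp only [Option.some.injEq] at hm
    subst hm
    simp only [Side.opp, nbr_right]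
    rw [dif_pos (by omega)]
    simp only [Option.some.injEq, Fin.ext_iff]
    omega
  · rw [nbr_right] at hm
    split_ifs at hm
    simp only [Option.some.injEq] at hm
    subst hm
    simp [Side.opp, nbr_left]

/- The involution `(k, γ) ↦ (m, γ.opp)` pairs the two sides of every interface. -/
theorem sum_faces_eq_zero (Z : Side → Fin d.ne → ℝ) (hend : ∀ γ k, d.nbr γ k = none → Z γ k = 0)
    (hint : ∀ γ k m, d.nbr γ k = some m → Z γ k + Z γ.opp m = 0) :
    ∑ k, ∑ γ : Side, Z γ k = 0 := by
  rw [← Fintype.sum_prod_type' (f := fun k γ => Z γ k)]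
  refine Finset.sum_involution
    (fun x _ => (d.nbr x.2 x.1).elim x fun m => (m, x.2.opp)) ?_ ?_ ?_ ?_
  · rintro ⟨k, γ⟩ -
    rcases hn : d.nbr γ k with _ | m
    · simp [hend γ k hn]
    · simp [hint γ k m hn]
  · rintro ⟨k, γ⟩ - hne
    rcases hn : d.nbr γ k with _ | m
    · exact absurd (hend γ k hn) hne
    · simp [Side.opp_ne]
  · exact fun _ _ => Finset.mem_univ _
  · rintro ⟨k, γ⟩ -
    rcases hn : d.nbr γ k with _ | m
    · simp [hn]
    · simp [nbr_opp hn]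

theorem sum_ends (hd : 0 < d.ne) (Y : Side → ℝ) :
    ∑ k, ∑ γ : Side, (d.nbr γ k).elim (Y γ) (fun _ => 0) = ∑ γ, Y γ := by
  rw [Finset.sum_comm]
  refine Finset.sum_congr rfl fun γ _ => ?_
  cases γ
  · rw [Finset.sum_eq_single ⟨0, hd⟩]
    · simp [nbr_left]
    · intro k _ hk
      have hpos : 0 < (k : ℕ) := Nat.pos_of_ne_zero fun h => hk (Fin.ext h)
      simp [nbr_left, hpos]
    · simp
  · rw [Finset.sum_eq_single ⟨d.ne - 1, by omega⟩]
    · rw [nbr_right, dif_neg (by simp only; omega)]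
      rfl
    · intro k _ hk
      have hne : (k : ℕ) ≠ d.ne - 1 := fun h => hk (Fin.ext h)
      have hlt : (k : ℕ) + 1 < d.ne := by omega
      simp [nbr_right, hlt]
    · simp

theorem size_le_h (d : Discretization n) (k : Fin d.ne) : (d.elem k).size ≤ d.h :=
  le_ciSup (f := fun k => (d.elem k).size) (Set.finite_range _).bddAbove k

theorem h_nonneg (d : Discretization n) : 0 ≤ d.h :=
  Real.iSup_nonneg fun k => (d.elem k).size_nonneg

end Mesh

namespace Tessellates

variable (hT : d.Tessellates a b)

include hT

theorem sum_normal_mul (Φ : ℝ → ℝ) :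
    ∑ k, ∑ γ : Side, γ.normal * Φ ((d.elem k).bdry γ) =
      ∑ γ : Side, γ.normal * Φ (domainEnd a b γ) := by
  rw [← sum_ends hT.ne_pos (fun γ => γ.normal * Φ (domainEnd a b γ)), ← sub_eq_zero]
  simp only [← Finset.sum_sub_distrib]
  refine sum_faces_eq_zero (fun γ k => γ.normal * Φ ((d.elem k).bdry γ) -
    (d.nbr γ k).elim (γ.normal * Φ (domainEnd a b γ)) fun _ => 0)
    (fun γ k hn => ?_) (fun γ k m hn => ?_)
  · simp [hn, hT.boundary γ k hn]
  · simp [hn, nbr_opp hn, hT.interior γ k m hn]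

variable (hE : ∀ k, (d.elem k).IsSBP p)

include hE

theorem left_mem (j : ℕ) (hj : j < d.ne) : a ≤ (d.elem ⟨j, hj⟩).bdry Side.left := by
  induction j with
  | zero => exact (hT.boundary Side.left ⟨0, hj⟩ (by simp [nbr_left])).ge
  | succ j ih =>
    rw [hT.interior Side.left ⟨j + 1, hj⟩ ⟨j, by omega⟩ (by simp [nbr_left])]
    exact (ih (by omega)).trans (hE _).bdry_lt.le

theorem right_mem (j : ℕ) (hj : j < d.ne) : (d.elem ⟨j, hj⟩).bdry Side.right ≤ b := by
  induction hi : d.ne - (j + 1) generalizing j with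
  | zero =>
    exact (hT.boundary Side.right ⟨j, hj⟩ (by rw [nbr_right, dif_neg (by simp only; omega)])).le
  | succ i ih =>
    rw [hT.interior Side.right ⟨j, hj⟩ ⟨j + 1, by omega⟩
      (by rw [nbr_right, dif_pos (by simp only; omega)])]
    exact (hE _).bdry_lt.le.trans (ih (j + 1) (by omega) (by omega))

theorem bdry_mem (k : Fin d.ne) (γ : Side) : (d.elem k).bdry γ ∈ Icc a b := by
  have hleft := hT.left_mem hE k k.2
  have hright := hT.right_mem hE k k.2
  have hlt := ((hE k).bdry_lt).le
  cases γ
  · exact ⟨hleft, hlt.trans hright⟩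
  · exact ⟨hleft.trans hlt, hright⟩

end Tessellates

/-- The discretizations of degree `p` of the problem with coefficient `lam` on `[a, b]` that are
tessellations, scale with the constant `C` and are adjoint consistent. -/
structure IsAdmissible (d : Discretization n) (a b : ℝ) (p : ℕ) (bc : Side → BC) (lam : ℝ → ℝ)
    (C : ℝ) : Prop where
  tessellates : d.Tessellates a b
  isSBP k : (d.elem k).IsSBP p
  kind k : (d.elem k).IsNarrow p ∨ (d.elem k).IsWide
  scaled : d.Scaled bc C
  adjointConsistent : d.AdjointConsistent lam

end Discretization

namespace Discretization

variable {n p : ℕ} {a b : ℝ}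

/-- The discretization whose primal problem is the discrete adjoint problem of `d`, if `d` is
adjoint consistent. -/
abbrev dual (d : Discretization n) : Discretization n :=
  { d with T2 := fun γ k => d.T3 γ k - 1, T3 := fun γ k => d.T2 γ k + 1 }

/-- The combination `t + σ t'` of the two values of `t` at the face `γ` of element `k`, and `t`
itself at an end of the domain: with `σ = -1` the jump of the traces, with `σ = 1` the jump of the
fluxes, which are taken along the outward normal of either element. -/
def mismatch (d : Discretization n) (σ : ℝ) (t : Side → Fin d.ne → ℝ) (γ : Side) (k : Fin d.ne) :
    ℝ :=
  (d.nbr γ k).elim (t γ k) fun m => t γ k + σ * t γ.opp m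

/-- The SAT coefficients at the face `γ` of element `k`. Column `0` multiplies the mismatch of the
traces and column `1` that of the fluxes; row `0` is the coefficient of `R_γ` and row `1` that of
`D_γ`. -/
def penalty (d : Discretization n) (bc : Side → BC) (γ : Side) (k : Fin d.ne) :
    Matrix (Fin 2) (Fin 2) ℝ :=
  (d.nbr γ k).elim
    (match bc γ with
      | BC.dirichlet => !![d.TD γ, 0; -1, 0]
      | BC.neumann => !![0, 1; 0, 0])
    fun _ => !![d.T1 γ k, d.T3 γ k; d.T2 γ k, d.T4 γ k]

/-- The face terms of the discrete bilinear form, for a trial function with traces `t` and fluxes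
`f` and a test function with traces `s` and fluxes `g`. -/
def faceForm (d : Discretization n) (bc : Side → BC) (t f s g : Side → Fin d.ne → ℝ) (γ : Side)
    (k : Fin d.ne) : ℝ :=
  (d.penalty bc γ k 0 0 * d.mismatch (-1) t γ k + d.penalty bc γ k 0 1 * d.mismatch 1 f γ k) * s γ k
    + (d.penalty bc γ k 1 0 * d.mismatch (-1) t γ k + d.penalty bc γ k 1 1 * d.mismatch 1 f γ k) *
      g γ k
    - s γ k * f γ k

/-- The boundary terms of the discrete load functional, for a test function with traces `s` and
fluxes `g`. -/
def faceLoad (d : Discretization n) (bc : Side → BC) (data : Side → ℝ) (s g : Side → Fin d.ne → ℝ)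
    (γ : Side) (k : Fin d.ne) : ℝ :=
  (d.nbr γ k).elim
    (match bc γ with
      | BC.dirichlet => data γ * (d.TD γ * s γ k - g γ k)
      | BC.neumann => data γ * s γ k)
    fun _ => 0

/-- The bilinear form of the discretization in weak form, with trial function `v` and test
function `z`. -/
def form (d : Discretization n) (bc : Side → BC) (lam : ℝ → ℝ) (v z : Fin d.ne → Fin n → ℝ) : ℝ :=
  ∑ k, (z k ⬝ᵥ ((d.elem k).M lam *ᵥ v k) +
    ∑ γ : Side, d.faceForm bc (d.tr v) (d.fl lam v) (d.tr z) (d.fl lam z) γ k)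

/-- The load functional of the discretization in weak form, with source `S`. -/
def load (d : Discretization n) (bc : Side → BC) (lam : ℝ → ℝ) (data : Side → ℝ) (S : ℝ → ℝ)
    (z : Fin d.ne → Fin n → ℝ) : ℝ :=
  ∑ k, (∑ i, (d.elem k).w i * z k i * S ((d.elem k).node i) +
    ∑ γ : Side, d.faceLoad bc data (d.tr z) (d.fl lam z) γ k)

/-- The part of the discrete functional that does not depend on the discrete solution. -/
def dirichletConst (d : Discretization n) (bc : Side → BC) (dataF data : Side → ℝ) : ℝ :=
  ∑ γ : Side, match bc γ with
    | BC.dirichlet => dataF γ * d.TD γ * data γ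
    | BC.neumann => 0

variable {d : Discretization n} {bc : Side → BC} {lam : ℝ → ℝ} {data : Side → ℝ} {S : ℝ → ℝ}

section Cases

variable {t f s g : Side → Fin d.ne → ℝ} {γ : Side} {k m : Fin d.ne}

theorem faceForm_of_some (hm : d.nbr γ k = some m) : d.faceForm bc t f s g γ k =
    (d.T1 γ k * (t γ k - t γ.opp m) + d.T3 γ k * (f γ k + f γ.opp m)) * s γ k +
      (d.T2 γ k * (t γ k - t γ.opp m) + d.T4 γ k * (f γ k + f γ.opp m)) * g γ k -
      s γ k * f γ k := by
  simp [faceForm, penalty, mismatch, hm, sub_eq_add_neg]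

theorem faceForm_of_dirichlet (hn : d.nbr γ k = none) (hb : bc γ = BC.dirichlet) :
    d.faceForm bc t f s g γ k = d.TD γ * t γ k * s γ k - t γ k * g γ k - s γ k * f γ k := by
  simp [faceForm, penalty, mismatch, hn, hb, sub_eq_add_neg]

theorem faceForm_of_neumann (hn : d.nbr γ k = none) (hb : bc γ = BC.neumann) :
    d.faceForm bc t f s g γ k = 0 := by
  simp [faceForm, penalty, mismatch, hn, hb, mul_comm]

theorem faceLoad_of_some (hm : d.nbr γ k = some m) : d.faceLoad bc data s g γ k = 0 := by
  simp [faceLoad, hm]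

theorem faceLoad_of_dirichlet (hn : d.nbr γ k = none) (hb : bc γ = BC.dirichlet) :
    d.faceLoad bc data s g γ k = data γ * (d.TD γ * s γ k - g γ k) := by
  simp [faceLoad, hn, hb]

theorem faceLoad_of_neumann (hn : d.nbr γ k = none) (hb : bc γ = BC.neumann) :
    d.faceLoad bc data s g γ k = data γ * s γ k := by
  simp [faceLoad, hn, hb]

end Cases

section Linearity

variable (t t' f f' s s' g g' : Side → Fin d.ne → ℝ) (γ : Side) (k : Fin d.ne)

theorem mismatch_add (σ : ℝ) :
    d.mismatch σ (t + t') γ k = d.mismatch σ t γ k + d.mismatch σ t' γ k := by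
  unfold mismatch
  cases d.nbr γ k
  · rfl
  · simp only [Option.elim, Pi.add_apply]
    ring

theorem faceForm_add_left : d.faceForm bc (t + t') (f + f') s g γ k =
    d.faceForm bc t f s g γ k + d.faceForm bc t' f' s g γ k := by
  simp only [faceForm, mismatch_add, Pi.add_apply]
  ring

theorem faceForm_add_right : d.faceForm bc t f (s + s') (g + g') γ k =
    d.faceForm bc t f s g γ k + d.faceForm bc t f s' g' γ k := by
  simp only [faceForm, Pi.add_apply]
  ring

theorem faceLoad_add : d.faceLoad bc data (s + s') (g + g') γ k =
    d.faceLoad bc data s g γ k + d.faceLoad bc data s' g' γ k := by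
  unfold faceLoad
  cases d.nbr γ k
  · cases bc γ <;> simp only [Option.elim, Pi.add_apply] <;> ring
  · exact (add_zero 0).symm

variable (v z : Fin d.ne → Fin n → ℝ)

theorem tr_add : d.tr (v + z) = d.tr v + d.tr z := by
  ext γ k
  exact dotProduct_add _ _ _

theorem fl_add : d.fl lam (v + z) = d.fl lam v + d.fl lam z := by
  ext γ k
  exact dotProduct_add _ _ _

theorem form_add_right (z' : Fin d.ne → Fin n → ℝ) :
    d.form bc lam v (z + z') = d.form bc lam v z + d.form bc lam v z' := by
  simp only [form, tr_add, fl_add, faceForm_add_right, Pi.add_apply, add_dotProduct,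
    Finset.sum_add_distrib]
  ring

theorem load_add :
    d.load bc lam data S (v + z) = d.load bc lam data S v + d.load bc lam data S z := by
  simp only [load, tr_add, fl_add, faceLoad_add, Pi.add_apply, mul_add, add_mul,
    Finset.sum_add_distrib]
  ring

end Linearity

section WeakForm

theorem dotProduct_sat (v z : Fin d.ne → Fin n → ℝ) (k : Fin d.ne) :
    z k ⬝ᵥ d.sat bc lam data v k =
      ∑ γ : Side, (d.faceForm bc (d.tr v) (d.fl lam v) (d.tr z) (d.fl lam z) γ k +
        d.tr z γ k * d.fl lam v γ k - d.faceLoad bc data (d.tr z) (d.fl lam z) γ k) := by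
  rw [sat, dotProduct_sum]
  refine Finset.sum_congr rfl fun γ _ => ?_
  have hR : z k ⬝ᵥ (d.elem k).R γ = d.tr z γ k := dotProduct_comm _ _
  have hDn : z k ⬝ᵥ (d.elem k).Dn lam γ = d.fl lam z γ k := dotProduct_comm _ _
  rcases hn : d.nbr γ k with _ | m
  · rcases hb : bc γ with _ | _
    · rw [faceForm_of_dirichlet hn hb, faceLoad_of_dirichlet hn hb]
      simp only [boundarySAT, hb, dotProduct_smul, dotProduct_sub, hR, hDn, smul_eq_mul]
      ring
    · rw [faceForm_of_neumann hn hb, faceLoad_of_neumann hn hb]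
      simp only [boundarySAT, hb, dotProduct_smul, hR, smul_eq_mul]
      ring
  · rw [faceForm_of_some hn, faceLoad_of_some hn]
    simp only [interfaceSAT, dotProduct_add, dotProduct_smul, hR, hDn, smul_eq_mul]
    ring

theorem SolvesPrimal.form_eq_load {v : Fin d.ne → Fin n → ℝ} (hv : d.SolvesPrimal bc lam data v S)
    (hE : ∀ k, (d.elem k).IsSBP p) (z : Fin d.ne → Fin n → ℝ) :
    d.form bc lam v z = d.load bc lam data S z := by
  refine Finset.sum_congr rfl fun k _ => ?_
  have hk := congrArg (fun y => ∑ i, (d.elem k).w i * z k i * y i) (hv k)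
  simp only [Pi.sub_apply, Pi.add_apply, mul_sub, mul_add, Finset.sum_sub_distrib,
    Finset.sum_add_distrib, Pi.zero_apply, mul_zero, Finset.sum_const_zero] at hk
  rw [(hE k).sum_w_mul_D2, ← SBPElement.dotProduct_H_mulVec _ (z k) ((d.elem k).H⁻¹ *ᵥ _),
    mulVec_mulVec, mul_nonsing_inv _ (hE k).isUnit_det_H, one_mulVec, dotProduct_sat] at hk
  simp only [Finset.sum_sub_distrib, Finset.sum_add_distrib, tr, fl, SBPElement.restrict] at hk ⊢
  linarith

theorem discreteFunctional_eq (hd : 0 < d.ne) (v : Fin d.ne → Fin n → ℝ) (dataF : Side → ℝ) :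
    d.discreteFunctional bc lam data v S dataF =
      d.load bc lam dataF S v - d.dirichletConst bc dataF data := by
  rw [dirichletConst, ← sum_ends hd, discreteFunctional, load, ← Finset.sum_add_distrib,
    ← Finset.sum_sub_distrib]
  refine Finset.sum_congr rfl fun k _ => ?_
  rw [SBPElement.dotProduct_H_mulVec, add_sub_assoc, ← Finset.sum_sub_distrib]
  congr 1
  · exact Finset.sum_congr rfl fun i _ => mul_right_comm _ _ _
  · refine Finset.sum_congr rfl fun γ _ => ?_
    rcases hn : d.nbr γ k with _ | m
    · rcases hb : bc γ with _ | _
      · simp only [faceLoad, hn, hb, Option.elim]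
        ring
      · simp [faceLoad, hn, hb]
    · simp [faceLoad, hn]

end WeakForm

section Duality

theorem AdjointConsistent.coeff_opp (hA : d.AdjointConsistent lam) {γ : Side} {k m : Fin d.ne}
    (hm : d.nbr γ k = some m) : d.T1 γ.opp m = d.T1 γ k ∧ d.T2 γ.opp m = -(d.T2 γ k + 1) ∧
      d.T3 γ.opp m = -(d.T3 γ k - 1) ∧ d.T4 γ.opp m = d.T4 γ k := by
  refine ⟨(hA.T1_eq γ k m hm).symm, ?_, ?_, (hA.T4_eq γ k m hm).symm⟩
  · rw [hA.T2_eq γ k m hm, neg_neg]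
  · rw [hA.T3_eq γ k m hm, neg_neg]

theorem sum_dual_faceForm (hA : d.AdjointConsistent lam) (t f s g : Side → Fin d.ne → ℝ) :
    ∑ k, ∑ γ : Side, d.dual.faceForm bc s g t f γ k =
      ∑ k, ∑ γ : Side, d.faceForm bc t f s g γ k := by
  suffices hsub : ∑ k : Fin d.ne, ∑ γ : Side,
      (d.dual.faceForm bc s g t f γ k - d.faceForm bc t f s g γ k) = 0 by
    simp only [Finset.sum_sub_distrib] at hsub
    exact sub_eq_zero.mp hsub
  refine sum_faces_eq_zero (d := d) _ (fun γ k hn => ?_) fun γ k m hm => ?_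
  · rcases hb : bc γ with _ | _
    · rw [faceForm_of_dirichlet hn hb, faceForm_of_dirichlet (d := d.dual) hn hb]
      ring
    · rw [faceForm_of_neumann hn hb, faceForm_of_neumann (d := d.dual) hn hb, sub_zero]
  · obtain ⟨h1, h2, h3, h4⟩ := hA.coeff_opp hm
    rw [faceForm_of_some hm, faceForm_of_some (d := d.dual) hm,
      faceForm_of_some (nbr_opp hm), faceForm_of_some (d := d.dual) (nbr_opp hm), Side.opp_opp]
    simp only [h1, h2, h3, h4]
    ring

theorem dual_form (hA : d.AdjointConsistent lam) (hE : ∀ k, (d.elem k).IsSBP p)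
    (hk : ∀ k, (d.elem k).IsNarrow p ∨ (d.elem k).IsWide) (v z : Fin d.ne → Fin n → ℝ) :
    d.dual.form bc lam z v = d.form bc lam v z := by
  unfold form
  rw [Finset.sum_add_distrib, Finset.sum_add_distrib]
  exact congrArg₂ _ (Finset.sum_congr rfl fun k _ => (hE k).M_comm (hk k) lam (z k) (v k))
    (sum_dual_faceForm hA _ _ _ _)

theorem AdjointConsistent.solvesPrimal_dual_iff (hA : d.AdjointConsistent lam)
    {v : Fin d.ne → Fin n → ℝ} :
    d.dual.SolvesPrimal bc lam data v S ↔ d.SolvesAdjoint bc lam data v S := by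
  refine forall_congr' fun k => ?_
  have hsat : d.dual.sat bc lam data v k = d.satAdj bc lam data v k := by
    refine Finset.sum_congr rfl fun γ _ => ?_
    have hnbr : d.dual.nbr γ k = d.nbr γ k := rfl
    rcases hm : d.nbr γ k with _ | m
    · rw [hnbr, hm]
      rfl
    · obtain ⟨h1, h2, h3, h4⟩ := hA.coeff_opp hm
      rw [hnbr, hm]
      simp only [interfaceSAT, interfaceSATAdj, h1, h2, h3, h4]
      congr 2 <;> simp only [tr, fl] <;> ring
  rw [← hA.M_symm k, sub_self, zero_mulVec, mulVec_zero, add_zero, hsat]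

theorem AdjointConsistent.dual (hA : d.AdjointConsistent lam) : d.dual.AdjointConsistent lam where
  T1_eq := hA.T1_eq
  T2_eq γ k m hm := by
    have h := hA.T3_eq γ k m hm
    linarith
  T3_eq γ k m hm := by
    have h := hA.T2_eq γ k m hm
    linarith
  T4_eq := hA.T4_eq
  M_symm := hA.M_symm

theorem AdjointConsistent.solvesAdjoint_dual_iff (hA : d.AdjointConsistent lam)
    {v : Fin d.ne → Fin n → ℝ} :
    d.dual.SolvesAdjoint bc lam data v S ↔ d.SolvesPrimal bc lam data v S := by
  have hT2 : (fun γ k => d.T2 γ k + 1 - 1) = d.T2 := by simp only [add_sub_cancel_right]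
  have hT3 : (fun γ k => d.T3 γ k - 1 + 1) = d.T3 := by simp only [sub_add_cancel]
  have hdual : SolvesPrimal
      { d with T2 := fun γ k => d.T2 γ k + 1 - 1, T3 := fun γ k => d.T3 γ k - 1 + 1 }
      bc lam data v S ↔ _ := hA.dual.solvesPrimal_dual_iff
  rw [hT2, hT3] at hdual
  exact hdual.symm

theorem dual_discreteFunctional (hd : 0 < d.ne) (v : Fin d.ne → Fin n → ℝ) (dataF : Side → ℝ) :
    d.dual.discreteFunctional bc lam data v S dataF = d.discreteFunctional bc lam data v S dataF :=
  (discreteFunctional_eq (d := d.dual) hd v dataF).trans (discreteFunctional_eq hd v dataF).symm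

theorem Tessellates.dual (hT : d.Tessellates a b) : d.dual.Tessellates a b :=
  ⟨hT.ne_pos, hT.interior, hT.boundary, hT.node_mem⟩

theorem Scaled.mono {C C' : ℝ} (h : d.Scaled bc C) (hC : C ≤ C') (hE : ∀ k, (d.elem k).IsSBP p) :
    d.Scaled bc C' where
  size_le k := (h.size_le k).trans
    (mul_le_mul_of_nonneg_right hC (sub_nonneg.mpr (hE k).bdry_lt.le))
  size_le_nbr γ k v hv := (h.size_le_nbr γ k v hv).trans
    (mul_le_mul_of_nonneg_right hC (SBPElement.size_nonneg _))
  R_le k γ i := (h.R_le k γ i).trans hC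
  w_le k i := (h.w_le k i).trans (mul_le_mul_of_nonneg_right hC (SBPElement.size_nonneg _))
  D_le k i j := (h.D_le k i j).trans hC
  Db_le k i j := (h.Db_le k i j).trans hC
  Mbar_le k l i j := (h.Mbar_le k l i j).trans hC
  T1_le γ k v hv := (h.T1_le γ k v hv).trans hC
  T2_le γ k v hv := (h.T2_le γ k v hv).trans hC
  T3_le γ k v hv := (h.T3_le γ k v hv).trans hC
  T4_le γ k v hv := (h.T4_le γ k v hv).trans
    (mul_le_mul_of_nonneg_right hC (SBPElement.size_nonneg _))
  TD_le γ k hv hb := (h.TD_le γ k hv hb).trans hC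

theorem Scaled.dual {C : ℝ} (h : d.Scaled bc C) (hE : ∀ k, (d.elem k).IsSBP p) :
    d.dual.Scaled bc (C + 1) :=
  have h' : d.Scaled bc (C + 1) := h.mono (le_add_of_nonneg_right zero_le_one) hE
  { size_le := h'.size_le
    size_le_nbr := h'.size_le_nbr
    R_le := h'.R_le
    w_le := h'.w_le
    D_le := h'.D_le
    Db_le := h'.Db_le
    Mbar_le := h'.Mbar_le
    T1_le := h'.T1_le
    T2_le γ k v hv := (abs_sub _ _).trans (add_le_add (h.T3_le γ k v hv) abs_one.le)
    T3_le γ k v hv := (abs_add_le _ _).trans (add_le_add (h.T2_le γ k v hv) abs_one.le)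
    T4_le := h'.T4_le
    TD_le := h'.TD_le }

theorem IsAdmissible.dual {C : ℝ} (h : d.IsAdmissible a b p bc lam C) :
    d.dual.IsAdmissible a b p bc lam (C + 1) :=
  ⟨h.tessellates.dual, h.isSBP, h.kind, h.scaled.dual h.isSBP, h.adjointConsistent.dual⟩

end Duality

end Discretization

/-! ### Representation of the functional error -/

section ContinuousProblem

variable {a b : ℝ} {bc : Side → BC} {lam F G S U V ψ : ℝ → ℝ} {uB ψB : Side → ℝ} {r : ℕ}

theorem exists_primitive (hab : a < b) {W : ℝ → ℝ} (hW : ContDiffOn ℝ r W (Icc a b)) :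
    ∃ Φ : ℝ → ℝ, ContDiffOn ℝ ((r + 1 : ℕ) : WithTop ℕ∞) Φ (Icc a b) ∧
      (∀ x ∈ Icc a b, derivWithin Φ (Icc a b) x = W x) ∧ ∫ x in a..b, W x = Φ b - Φ a := by
  set g : ℝ → ℝ := IccExtend hab.le ((Icc a b).domRestrict W) with hg
  have hgc : Continuous g :=
    (continuousOn_iff_continuous_domRestrict.mp hW.continuousOn).Icc_extend'
  have hgW : ∀ x ∈ Icc a b, g x = W x := fun x hx => by
    rw [hg, IccExtend_of_mem hab.le _ hx]
    rfl
  have hd : ∀ x, HasDerivAt (fun x => ∫ t in a..x, g t) (g x) x := fun x =>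
    intervalIntegral.integral_hasDerivAt_right (hgc.intervalIntegrable _ _)
      (hgc.stronglyMeasurableAtFilter _ _) hgc.continuousAt
  have hd' : ∀ x ∈ Icc a b, derivWithin (fun x => ∫ t in a..x, g t) (Icc a b) x = W x :=
    fun x hx => by
      rw [(hd x).hasDerivWithinAt.derivWithin (uniqueDiffOn_Icc hab x hx), hgW x hx]
  refine ⟨fun x => ∫ t in a..x, g t, ?_, hd', ?_⟩
  · have hcast : ((r + 1 : ℕ) : WithTop ℕ∞) = (r : WithTop ℕ∞) + 1 := by push_cast; rfl
    rw [hcast, contDiffOn_succ_iff_derivWithin (uniqueDiffOn_Icc hab)]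
    exact ⟨fun x _ => (hd x).differentiableAt.differentiableWithinAt, by simp, hW.congr hd'⟩
  · simp only [intervalIntegral.integral_same, sub_zero]
    refine intervalIntegral.integral_congr fun x hx => ?_
    rw [uIcc_of_le hab.le] at hx
    exact (hgW x hx).symm

theorem hasDerivWithinAt_flux_mul (hab : a < b) (hlam : ContDiffOn ℝ 1 lam (Icc a b))
    (hU : ContDiffOn ℝ 2 U (Icc a b)) (hψ : DifferentiableOn ℝ ψ (Icc a b)) {x : ℝ}
    (hx : x ∈ Icc a b) :
    HasDerivWithinAt (fun x => flux a b lam U x * ψ x)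
      (derivWithin (flux a b lam U) (Icc a b) x * ψ x +
        flux a b lam U x * derivWithin ψ (Icc a b) x) (Icc a b) x :=
  have hflux : DifferentiableOn ℝ (flux a b lam U) (Icc a b) :=
    (contDiffOn_flux (r := 1) hab (by simpa using hlam) (by simpa using hU)).differentiableOn
      (by norm_num)
  (hflux x hx).hasDerivWithinAt.mul (hψ x hx).hasDerivWithinAt

theorem SolvesDiffusion.contDiffOn_source (hab : a < b)
    (hlam : ContDiffOn ℝ ((r + 1 : ℕ) : WithTop ℕ∞) lam (Icc a b))
    (hVs : ContDiffOn ℝ ((r + 2 : ℕ) : WithTop ℕ∞) V (Icc a b))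
    (hV : SolvesDiffusion a b bc lam S V uB) : ContDiffOn ℝ r S (Icc a b) :=
  ((contDiffOn_flux hab hlam hVs).derivWithin (uniqueDiffOn_Icc hab)
    (by norm_cast)).neg.congr fun x hx => (hV.pde x hx).symm

theorem green_second_identity (hab : a < b) (hlam : ContDiffOn ℝ 1 lam (Icc a b))
    (hUs : ContDiffOn ℝ 2 U (Icc a b)) (hψs : ContDiffOn ℝ 2 ψ (Icc a b))
    (hU : SolvesDiffusion a b bc lam F U uB) (hψ : SolvesDiffusion a b bc lam G ψ ψB) :
    (∫ x in a..b, G x * U x) - ∫ x in a..b, F x * ψ x =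
      ∑ γ : Side, (normalFlux a b lam U γ * ψ (domainEnd a b γ) -
        normalFlux a b lam ψ γ * U (domainEnd a b γ)) := by
  have hF : ContinuousOn F (Icc a b) :=
    (hU.contDiffOn_source (r := 0) hab (by simpa using hlam) (by simpa using hUs)).continuousOn
  have hG : ContinuousOn G (Icc a b) :=
    (hψ.contDiffOn_source (r := 0) hab (by simpa using hlam) (by simpa using hψs)).continuousOn
  have hGU : IntervalIntegrable (fun x => G x * U x) MeasureTheory.volume a b :=
    (hG.mul hUs.continuousOn).intervalIntegrable_of_Icc hab.le
  have hFψ : IntervalIntegrable (fun x => F x * ψ x) MeasureTheory.volume a b :=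
    (hF.mul hψs.continuousOn).intervalIntegrable_of_Icc hab.le
  have hderiv : ∀ x ∈ Icc a b, HasDerivWithinAt
      (fun x => flux a b lam U x * ψ x - flux a b lam ψ x * U x)
      (G x * U x - F x * ψ x) (Icc a b) x := fun x hx => by
    refine ((hasDerivWithinAt_flux_mul hab hlam hUs (hψs.differentiableOn (by norm_num)) hx).sub
      (hasDerivWithinAt_flux_mul hab hlam hψs (hUs.differentiableOn (by norm_num))
        hx)).congr_deriv ?_
    rw [← hU.pde x hx, ← hψ.pde x hx]
    simp only [flux]
    ring
  rw [← intervalIntegral.integral_sub hGU hFψ,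
    intervalIntegral.integral_eq_sub_of_hasDerivAt_of_le hab.le
      (fun x hx => (hderiv x hx).continuousWithinAt)
      (fun x hx => (hderiv x (Ioo_subset_Icc_self hx)).hasDerivAt (Icc_mem_nhds hx.1 hx.2))
      (hGU.sub hFψ)]
  simp only [normalFlux, mul_assoc, ← mul_sub, Side.sum_normal_mul, domainEnd]

theorem functional_eq (hab : a < b) (hlam : ContDiffOn ℝ 1 lam (Icc a b))
    (hUs : ContDiffOn ℝ 2 U (Icc a b)) (hψs : ContDiffOn ℝ 2 ψ (Icc a b))
    (hU : SolvesDiffusion a b bc lam F U uB) (hψ : SolvesDiffusion a b bc lam G ψ ψB) :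
    functional a b bc lam G ψB U = functional a b bc lam F uB ψ := by
  rw [functional, functional, ← sub_eq_zero, add_sub_add_comm,
    green_second_identity hab hlam hUs hψs hU hψ, ← Finset.sum_sub_distrib,
    ← Finset.sum_add_distrib]
  refine Finset.sum_eq_zero fun γ _ => ?_
  rcases hb : bc γ with _ | _
  · simp only [← hU.dirichlet γ hb, ← hψ.dirichlet γ hb]
    ring
  · simp only [← hU.neumann γ hb, ← hψ.neumann γ hb]
    ring

end ContinuousProblem

theorem SBPElement.weakResidual_restrict {n : ℕ} (E : SBPElement n) {a b : ℝ} (hab : a < b)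
    {lam U ψ : ℝ → ℝ} (hlam : ContDiffOn ℝ 1 lam (Icc a b)) (hU : ContDiffOn ℝ 2 U (Icc a b))
    (hψ : DifferentiableOn ℝ ψ (Icc a b)) (hE : ∀ i, E.node i ∈ Icc a b) :
    E.weakResidual a b lam U (E.restrict ψ) =
      E.formDefect (.of a b lam) (.of a b U) (.of a b ψ) +
      E.quadratureError a b (fun x => flux a b lam U x * ψ x) +
      ∑ γ : Side, γ.normal * (flux a b lam ψ (E.bdry γ) *
        (E.R γ ⬝ᵥ E.restrict U - U (E.bdry γ))) := by
  have hquad : ∑ i, E.w i * derivWithin (fun x => flux a b lam U x * ψ x) (Icc a b) (E.node i) =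
      ∑ i, E.w i * E.restrict ψ i * derivWithin (flux a b lam U) (Icc a b) (E.node i) +
      ∑ i, E.w i * (lam (E.node i) *
        (derivWithin U (Icc a b) (E.node i) * derivWithin ψ (Icc a b) (E.node i))) := by
    rw [← Finset.sum_add_distrib]
    refine Finset.sum_congr rfl fun i _ => ?_
    rw [(hasDerivWithinAt_flux_mul hab hlam hU hψ (hE i)).derivWithin
      (uniqueDiffOn_Icc hab _ (hE i))]
    simp only [flux, restrict]
    ring
  rw [weakResidual, quadratureError, hquad, formDefect]
  simp only [Jet.of, flux, mul_add, mul_sub, Finset.sum_add_distrib, Finset.sum_sub_distrib,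
    mul_assoc, mul_left_comm, mul_comm]
  ring

namespace Discretization

variable {n p : ℕ} {a b : ℝ} {d : Discretization n} {bc : Side → BC} {lam : ℝ → ℝ}

/-- The restriction of a function to the nodes of all elements. -/
def restrict (d : Discretization n) (V : ℝ → ℝ) : Fin d.ne → Fin n → ℝ :=
  fun k => (d.elem k).restrict V

/-- The traces of a function at the ends of the elements. -/
def exactTr (d : Discretization n) (V : ℝ → ℝ) (γ : Side) (k : Fin d.ne) : ℝ :=
  V ((d.elem k).bdry γ)

/-- The fluxes of a function at the ends of the elements, along the outward normals. -/
def exactFl (d : Discretization n) (a b : ℝ) (lam V : ℝ → ℝ) (γ : Side) (k : Fin d.ne) : ℝ :=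
  γ.normal * flux a b lam V ((d.elem k).bdry γ)

/-- The errors of the extrapolated traces of a function. -/
def trError (d : Discretization n) (V : ℝ → ℝ) : Side → Fin d.ne → ℝ :=
  d.tr (d.restrict V) - d.exactTr V

/-- The errors of the extrapolated fluxes of a function. -/
def flError (d : Discretization n) (a b : ℝ) (lam V : ℝ → ℝ) : Side → Fin d.ne → ℝ :=
  d.fl lam (d.restrict V) - d.exactFl a b lam V

section ErrorRepresentation

variable {F G U ψ : ℝ → ℝ} {uB ψB : Side → ℝ}

theorem exactTr_add_trError (V : ℝ → ℝ) : d.exactTr V + d.trError V = d.tr (d.restrict V) :=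
  add_sub_cancel _ _

theorem exactFl_add_flError (V : ℝ → ℝ) :
    d.exactFl a b lam V + d.flError a b lam V = d.fl lam (d.restrict V) :=
  add_sub_cancel _ _

theorem Tessellates.faceForm_exact (hT : d.Tessellates a b)
    (hU : SolvesDiffusion a b bc lam F U uB) (s g : Side → Fin d.ne → ℝ) (γ : Side) (k : Fin d.ne) :
    d.faceForm bc (d.exactTr U) (d.exactFl a b lam U) s g γ k =
      d.faceLoad bc uB s g γ k - s γ k * d.exactFl a b lam U γ k := by
  rcases hn : d.nbr γ k with _ | m
  · have hbdry := hT.boundary γ k hn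
    rcases hb : bc γ with _ | _
    · rw [faceForm_of_dirichlet hn hb, faceLoad_of_dirichlet hn hb, ← hU.dirichlet γ hb, exactTr,
        hbdry]
      ring
    · rw [faceForm_of_neumann hn hb, faceLoad_of_neumann hn hb, ← hU.neumann γ hb, exactFl, hbdry,
        normalFlux]
      ring
  · rw [faceForm_of_some hn, faceLoad_of_some hn]
    simp only [exactTr, exactFl, hT.interior γ k m hn, Side.normal_opp]
    ring

theorem Tessellates.functional_eq (hT : d.Tessellates a b)
    (hU : SolvesDiffusion a b bc lam F U uB) (W : ℝ → ℝ) (dataF : Side → ℝ) :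
    functional a b bc lam W dataF U = (∫ x in a..b, W x * U x) +
      ∑ k, ∑ γ : Side, d.faceLoad bc dataF (d.exactTr U) (d.exactFl a b lam U) γ k -
      d.dirichletConst bc dataF uB := by
  rw [functional, dirichletConst, ← sum_ends hT.ne_pos, ← sum_ends hT.ne_pos, add_sub_assoc,
    ← Finset.sum_sub_distrib]
  congr 1
  refine Finset.sum_congr rfl fun k _ => ?_
  rw [← Finset.sum_sub_distrib]
  refine Finset.sum_congr rfl fun γ _ => ?_
  rcases hn : d.nbr γ k with _ | m
  · have hbdry := hT.boundary γ k hn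
    rcases hb : bc γ with _ | _
    · rw [faceLoad_of_dirichlet hn hb, exactTr, hbdry, hU.dirichlet γ hb, exactFl, hbdry]
      simp only [Option.elim, normalFlux]
      ring
    · rw [faceLoad_of_neumann hn hb, exactTr, hbdry]
      exact (sub_zero _).symm
  · rw [faceLoad_of_some hn]
    exact (sub_zero 0).symm

theorem Tessellates.form_restrict_sub_load (hT : d.Tessellates a b)
    (hU : SolvesDiffusion a b bc lam F U uB) (z : Fin d.ne → Fin n → ℝ) :
    d.form bc lam (d.restrict U) z - d.load bc lam uB F z =
      ∑ k, ((d.elem k).weakResidual a b lam U (z k) +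
        ∑ γ : Side,
          d.faceForm bc (d.trError U) (d.flError a b lam U) (d.tr z) (d.fl lam z) γ k) := by
  rw [form, load, ← Finset.sum_sub_distrib]
  refine Finset.sum_congr rfl fun k _ => ?_
  have hsource : ∑ i, (d.elem k).w i * z k i * F ((d.elem k).node i) =
      -∑ i, (d.elem k).w i * z k i *
        derivWithin (flux a b lam U) (Icc a b) ((d.elem k).node i) := by
    rw [← Finset.sum_neg_distrib]
    refine Finset.sum_congr rfl fun i _ => ?_
    rw [← hU.pde _ (hT.node_mem k i), mul_neg]
  have hface : ∑ γ : Side, (d.elem k).R γ ⬝ᵥ z k * d.exactFl a b lam U γ k =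
      ∑ γ : Side, γ.normal * ((d.elem k).R γ ⬝ᵥ z k * flux a b lam U ((d.elem k).bdry γ)) :=
    Finset.sum_congr rfl fun γ _ => mul_left_comm _ _ _
  rw [← exactTr_add_trError, ← exactFl_add_flError (a := a) (b := b)]
  simp only [faceForm_add_left, hT.faceForm_exact hU, Finset.sum_add_distrib,
    Finset.sum_sub_distrib]
  rw [hsource, SBPElement.weakResidual, ← hface]
  simp only [restrict, tr]
  ring

theorem AdjointConsistent.sum_faceForm_error (hA : d.AdjointConsistent lam)
    (hT : d.Tessellates a b) (hψ : SolvesDiffusion a b bc lam G ψ ψB)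
    (t f : Side → Fin d.ne → ℝ) :
    ∑ k, ∑ γ : Side,
        d.faceForm bc t f (d.tr (d.restrict ψ)) (d.fl lam (d.restrict ψ)) γ k =
      ∑ k, ∑ γ : Side, (d.faceLoad bc ψB t f γ k - t γ k * d.exactFl a b lam ψ γ k +
        d.faceForm bc t f (d.trError ψ) (d.flError a b lam ψ) γ k) := by
  rw [← exactTr_add_trError, ← exactFl_add_flError (a := a) (b := b)]
  simp only [faceForm_add_right, Finset.sum_add_distrib]
  rw [← sum_dual_faceForm hA t f (d.exactTr ψ)]
  simp only [← Finset.sum_add_distrib]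
  exact Finset.sum_congr rfl fun k _ => Finset.sum_congr rfl fun γ _ =>
    congrArg (· + _) (hT.dual.faceForm_exact hψ t f γ k)

/- The errors of the exact solution in the discrete primal problem, tested with `ψ`, cancel those of
the functional up to products of a primal and an adjoint error and quadrature errors. -/
theorem functional_sub_add_form_sub_load (hab : a < b) (hlam : ContDiffOn ℝ 1 lam (Icc a b))
    (hUs : ContDiffOn ℝ 2 U (Icc a b)) (hψs : DifferentiableOn ℝ ψ (Icc a b))
    (hT : d.Tessellates a b) (hA : d.AdjointConsistent lam)
    (hU : SolvesDiffusion a b bc lam F U uB) (hψ : SolvesDiffusion a b bc lam G ψ ψB)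
    {Φ : ℝ → ℝ} (hΦ : ∀ x ∈ Icc a b, derivWithin Φ (Icc a b) x = G x * U x)
    (hint : ∫ x in a..b, G x * U x = Φ b - Φ a) :
    functional a b bc lam G ψB U - d.discreteFunctional bc lam uB (d.restrict U) G ψB +
        (d.form bc lam (d.restrict U) (d.restrict ψ) - d.load bc lam uB F (d.restrict ψ)) =
      ∑ k, ((d.elem k).formDefect (.of a b lam) (.of a b U) (.of a b ψ) +
        (d.elem k).quadratureError a b (fun x => flux a b lam U x * ψ x) -
        (d.elem k).quadratureError a b Φ +
        ∑ γ : Side, d.faceForm bc (d.trError U) (d.flError a b lam U)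
          (d.trError ψ) (d.flError a b lam ψ) γ k) := by
  have hsource : ∫ x in a..b, G x * U x =
      ∑ k, ∑ i, (d.elem k).w i * d.restrict U k i * G ((d.elem k).node i) -
        ∑ k, (d.elem k).quadratureError a b Φ := by
    have hends := Side.sum_normal_mul fun γ => Φ (domainEnd a b γ)
    rw [← hT.sum_normal_mul Φ] at hends
    rw [hint, ← Finset.sum_sub_distrib]
    refine hends.symm.trans ?_
    refine Finset.sum_congr rfl fun k _ => ?_
    rw [SBPElement.quadratureError, sub_sub_eq_add_sub, eq_comm, sub_eq_iff_eq_add, add_comm]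
    congr 1
    refine Finset.sum_congr rfl fun i _ => ?_
    rw [hΦ _ (hT.node_mem k i), restrict, SBPElement.restrict]
    ring
  have hresidual (k : Fin d.ne) : (d.elem k).weakResidual a b lam U (d.restrict ψ k) =
      (d.elem k).formDefect (.of a b lam) (.of a b U) (.of a b ψ) +
      (d.elem k).quadratureError a b (fun x => flux a b lam U x * ψ x) +
      ∑ γ : Side, d.trError U γ k * d.exactFl a b lam ψ γ k := by
    refine ((d.elem k).weakResidual_restrict hab hlam hUs hψs (hT.node_mem k)).trans
      (congrArg _ (Finset.sum_congr rfl fun γ _ => ?_))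
    rw [← mul_assoc, mul_comm]
    rfl
  rw [hT.functional_eq hU, discreteFunctional_eq hT.ne_pos, hT.form_restrict_sub_load hU, load,
    hsource, ← exactTr_add_trError, ← exactFl_add_flError (a := a) (b := b)]
  simp only [faceLoad_add, Finset.sum_add_distrib, Finset.sum_sub_distrib, hresidual,
    hA.sum_faceForm_error hT hψ]
  ring

theorem discreteFunctional_sub {uh ψh : Fin d.ne → Fin n → ℝ} {C : ℝ}
    (hd : d.IsAdmissible a b p bc lam C) (huh : d.SolvesPrimal bc lam uB uh F)
    (hψh : d.SolvesAdjoint bc lam ψB ψh G) (v : Fin d.ne → Fin n → ℝ) :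
    d.discreteFunctional bc lam uB v G ψB - d.discreteFunctional bc lam uB uh G ψB =
      d.form bc lam v ψh - d.load bc lam uB F ψh := by
  have hadj (z : Fin d.ne → Fin n → ℝ) : d.form bc lam z ψh = d.load bc lam ψB G z := by
    rw [← dual_form hd.adjointConsistent hd.isSBP hd.kind]
    exact (hd.adjointConsistent.solvesPrimal_dual_iff.mpr hψh).form_eq_load hd.isSBP z
  rw [discreteFunctional_eq hd.tessellates.ne_pos, discreteFunctional_eq hd.tessellates.ne_pos,
    sub_sub_sub_cancel_right, ← hadj, ← hadj, huh.form_eq_load hd.isSBP]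

theorem functional_sub_discreteFunctional {uh ψh : Fin d.ne → Fin n → ℝ} {C : ℝ} (hab : a < b)
    (hlam : ContDiffOn ℝ 1 lam (Icc a b)) (hUs : ContDiffOn ℝ 2 U (Icc a b))
    (hψs : DifferentiableOn ℝ ψ (Icc a b)) (hd : d.IsAdmissible a b p bc lam C)
    (hU : SolvesDiffusion a b bc lam F U uB) (hψ : SolvesDiffusion a b bc lam G ψ ψB)
    (huh : d.SolvesPrimal bc lam uB uh F) (hψh : d.SolvesAdjoint bc lam ψB ψh G)
    {Φ : ℝ → ℝ} (hΦ : ∀ x ∈ Icc a b, derivWithin Φ (Icc a b) x = G x * U x)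
    (hint : ∫ x in a..b, G x * U x = Φ b - Φ a) :
    functional a b bc lam G ψB U - d.discreteFunctional bc lam uB uh G ψB =
      ∑ k, ((d.elem k).formDefect (.of a b lam) (.of a b U) (.of a b ψ) +
        (d.elem k).quadratureError a b (fun x => flux a b lam U x * ψ x) -
        (d.elem k).quadratureError a b Φ +
        ∑ γ : Side, d.faceForm bc (d.trError U) (d.flError a b lam U)
          (d.trError ψ) (d.flError a b lam ψ) γ k) -
      ∑ k, ((d.elem k).weakResidual a b lam U ((d.restrict ψ - ψh) k) +
        ∑ γ : Side, d.faceForm bc (d.trError U) (d.flError a b lam U)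
          (d.tr (d.restrict ψ - ψh)) (d.fl lam (d.restrict ψ - ψh)) γ k) := by
  have hsplit : d.restrict ψ = ψh + (d.restrict ψ - ψh) := (add_sub_cancel _ _).symm
  have hkey := functional_sub_add_form_sub_load hab hlam hUs hψs hd.tessellates
    hd.adjointConsistent hU hψ hΦ hint
  have hdiff := discreteFunctional_sub hd huh hψh (d.restrict U)
  have hform := form_add_right (bc := bc) (lam := lam) (d.restrict U) ψh (d.restrict ψ - ψh)
  have hload := load_add (bc := bc) (lam := lam) (data := uB) (S := F) ψh (d.restrict ψ - ψh)
  rw [← hsplit] at hform hload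
  rw [← hkey, ← hd.tessellates.form_restrict_sub_load hU]
  linarith

end ErrorRepresentation

end Discretization

/-! ### Estimates over all elements -/

namespace Discretization

theorem Scaled.abs_penalty_mul_size_le {n : ℕ} {d : Discretization n} {bc : Side → BC} {C : ℝ}
    (hS : d.Scaled bc C) (γ : Side) (k : Fin d.ne) (i j : Fin 2) :
    |d.penalty bc γ k i j| * (d.elem k).size ≤ max C 1 * (d.elem k).size ^ (i + j : ℕ) := by
  have hρ := (d.elem k).size_nonneg
  have hC : C ≤ max C 1 := le_max_left C 1
  have hone : 1 ≤ max C 1 := le_max_right C 1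
  have hself : (d.elem k).size ≤ max C 1 * (d.elem k).size := le_mul_of_one_le_left hρ hone
  have hCρ : C * (d.elem k).size ≤ max C 1 * (d.elem k).size := mul_le_mul_of_nonneg_right hC hρ
  rcases hn : d.nbr γ k with _ | m
  · rcases hb : bc γ with _ | _
    · have hTD := (hS.TD_le γ k hn hb).trans hC
      fin_cases i <;> fin_cases j
      · simpa [penalty, hn, hb] using hTD
      · simpa [penalty, hn, hb] using hρ.trans hself
      · simpa [penalty, hn, hb] using hself
      · simpa [penalty, hn, hb] using mul_nonneg (zero_le_one.trans hone) (pow_nonneg hρ 2)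
    · fin_cases i <;> fin_cases j
      · simp [penalty, hn, hb]
      · simpa [penalty, hn, hb] using hself
      · simpa [penalty, hn, hb] using hρ.trans hself
      · simpa [penalty, hn, hb] using mul_nonneg (zero_le_one.trans hone) (pow_nonneg hρ 2)
  · have hT1 := (hS.T1_le γ k m hn).trans hC
    have hT2 := mul_le_mul_of_nonneg_right ((hS.T2_le γ k m hn).trans hC) hρ
    have hT3 := mul_le_mul_of_nonneg_right ((hS.T3_le γ k m hn).trans hC) hρ
    have hT4 := mul_le_mul_of_nonneg_right ((hS.T4_le γ k m hn).trans hCρ) hρ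
    fin_cases i <;> fin_cases j
    · simpa [penalty, hn] using hT1
    · simpa [penalty, hn] using hT3
    · simpa [penalty, hn] using hT2
    · simpa [penalty, hn, pow_two, mul_assoc] using hT4

section Families

open Asymptotics Filter

variable {α : Type*} {n p : ℕ} {a b C : ℝ} {bc : Side → BC} {lam : ℝ → ℝ} {d : α → Discretization n}

/-- All elements of a family of discretizations, as one family of elements. -/
abbrev elems (d : α → Discretization n) (z : Σ x, Fin (d x).ne) : SBPElement n :=
  (d z.1).elem z.2

section FaceEstimates

variable (h : ∀ x, (d x).IsAdmissible a b p bc lam C)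

include h

theorem isRegularFamily_elems : SBPElement.IsRegularFamily a b p (elems d) where
  isSBP z := (h z.1).isSBP z.2
  kind z := (h z.1).kind z.2
  node_mem z := (h z.1).tessellates.node_mem z.2
  bdry_mem z := (h z.1).tessellates.bdry_mem (h z.1).isSBP z.2
  R_isBigO γ i := isBigO_top.mpr ⟨C, fun z => by
    simpa using (h z.1).scaled.R_le z.2 γ i⟩
  w_isBigO i := isBigO_top.mpr ⟨C, fun z => by
    rw [Real.norm_of_nonneg (((h z.1).isSBP z.2).w_pos i).le, SBPElement.norm_size]
    exact (h z.1).scaled.w_le z.2 i⟩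
  D_isBigO i j := isBigO_top.mpr ⟨C, fun z => by
    rw [norm_mul, mul_comm, SBPElement.norm_size, norm_one, mul_one]
    exact (h z.1).scaled.D_le z.2 i j⟩
  Db_isBigO i j := isBigO_top.mpr ⟨C, fun z => by
    rw [norm_mul, mul_comm, SBPElement.norm_size, norm_one, mul_one]
    exact (h z.1).scaled.Db_le z.2 i j⟩
  Mbar_isBigO l i j := isBigO_top.mpr ⟨C, fun z => by
    rw [norm_mul, mul_comm, SBPElement.norm_size, norm_one, mul_one]
    exact (h z.1).scaled.Mbar_le z.2 l i j⟩

theorem mismatch_isBigO {t : ∀ x, Side → Fin (d x).ne → ℝ} {m : ℕ}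
    (ht : ∀ γ, (fun z : Σ x, Fin (d x).ne => t z.1 γ z.2) =O[⊤] fun z => (elems d z).size ^ m)
    (σ : ℝ) (γ : Side) :
    (fun z : Σ x, Fin (d x).ne => (d z.1).mismatch σ (t z.1) γ z.2) =O[⊤]
      fun z => (elems d z).size ^ m := by
  let neighbor (z : Σ x, Fin (d x).ne) : Σ x, Fin (d x).ne :=
    ⟨z.1, ((d z.1).nbr γ z.2).getD z.2⟩
  have hsize : (fun z => (elems d (neighbor z)).size) =O[⊤] fun z => (elems d z).size := by
    refine isBigO_top.mpr ⟨max C 1, fun ⟨x, k⟩ => ?_⟩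
    rw [SBPElement.norm_size, SBPElement.norm_size]
    rcases hn : (d x).nbr γ k with _ | m
    · simpa [neighbor, hn] using
        le_mul_of_one_le_left (SBPElement.size_nonneg _) (le_max_right C 1)
    · simpa [neighbor, hn] using ((h x).scaled.size_le_nbr _ m k (nbr_opp hn)).trans
        (mul_le_mul_of_nonneg_right (le_max_left C 1) (SBPElement.size_nonneg _))
  have hneighbor := (((ht γ.opp).comp_tendsto (k := neighbor) tendsto_top).trans
    (hsize.pow m)).const_mul_left σ
  refine IsBigO.trans (isBigO_of_le _ fun z => ?_)
    ((ht γ).norm_left.add hneighbor.norm_left)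
  rw [Real.norm_of_nonneg (add_nonneg (norm_nonneg _) (norm_nonneg _))]
  rcases hn : (d z.1).nbr γ z.2 with _ | m
  · simpa [mismatch, hn] using mul_nonneg (abs_nonneg _) (abs_nonneg _)
  · simpa [mismatch, neighbor, hn] using norm_add_le (t z.1 γ z.2) (σ * t z.1 γ.opp m)

theorem penalty_isBigO (γ : Side) (i j : Fin 2) :
    (fun z : Σ x, Fin (d x).ne => (elems d z).size * (d z.1).penalty bc γ z.2 i j) =O[⊤]
      fun z => (elems d z).size ^ (i + j : ℕ) :=
  isBigO_top.mpr ⟨max C 1, fun ⟨x, k⟩ => by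
    rw [norm_mul, norm_pow, SBPElement.norm_size, mul_comm]
    exact (h x).scaled.abs_penalty_mul_size_le γ k i j⟩

variable (hp : 1 ≤ p) {t f s g : ∀ x, Side → Fin (d x).ne → ℝ} {m : ℕ}
  (ht : ∀ γ, (fun z : Σ x, Fin (d x).ne => t z.1 γ z.2) =O[⊤] fun z => (elems d z).size ^ (m + 1))
  (hf : ∀ γ, (fun z : Σ x, Fin (d x).ne => f z.1 γ z.2) =O[⊤] fun z => (elems d z).size ^ m)

include ht hf in
theorem size_mul_penalty_mismatch_isBigO (γ : Side) (i : Fin 2) :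
    (fun z : Σ x, Fin (d x).ne => (elems d z).size *
      ((d z.1).penalty bc γ z.2 i 0 * (d z.1).mismatch (-1) (t z.1) γ z.2 +
        (d z.1).penalty bc γ z.2 i 1 * (d z.1).mismatch 1 (f z.1) γ z.2)) =O[⊤]
      fun z => (elems d z).size ^ (m + 1 + i) := by
  have htrace := (penalty_isBigO h γ i 0).mul (mismatch_isBigO h ht (-1) γ)
  have hflux := (penalty_isBigO h γ i 1).mul (mismatch_isBigO h hf 1 γ)
  refine ((htrace.congr_right fun z => ?_).add (hflux.congr_right fun z => ?_)).congr_left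
    fun z => ?_
  · rw [← pow_add]
    congr 1
    simp only [Fin.val_zero]
    omega
  · rw [← pow_add]
    congr 1
    simp only [Fin.val_one]
    omega
  · ring

include hp ht hf in
theorem faceForm_isBigO {ν : (Σ x, Fin (d x).ne) → ℝ} (γ : Side)
    (hs : (fun z : Σ x, Fin (d x).ne => s z.1 γ z.2) =O[⊤] ν)
    (hg : (fun z : Σ x, Fin (d x).ne => (elems d z).size * g z.1 γ z.2) =O[⊤] ν) :
    (fun z : Σ x, Fin (d x).ne => (d z.1).faceForm bc (t z.1) (f z.1) (s z.1) (g z.1) γ z.2) =O[⊤]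
      fun z => ν z * (elems d z).size ^ m := by
  have hE := isRegularFamily_elems h
  have hcoeff := size_mul_penalty_mismatch_isBigO h ht hf γ
  have htest := (hcoeff 0).mul hs
  have hflux := hE.isBigO_of_size_mul hp le_rfl (m := m + 1) (ν := ν)
    (((hcoeff 1).mul hg).congr (fun z => mul_left_comm _ _ _) fun z => mul_comm _ _)
  have hown := hs.mul ((isBigO_refl (fun z => (elems d z).size) ⊤).mul (hf γ))
  refine hE.isBigO_of_size_mul hp le_rfl (((htest.congr_right fun z => ?_).add hflux).sub
    (hown.congr_right fun z => ?_) |>.congr_left fun z => ?_)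
  · exact mul_comm _ _
  · rw [pow_succ']
  · simp only [faceForm]
    ring

end FaceEstimates

section ConsistencyErrors

variable (h : ∀ x, (d x).IsAdmissible a b p bc lam C) (hp : 1 ≤ p) (hab : a < b) {V : ℝ → ℝ}
  (hV : ContDiffOn ℝ ((p + 1 : ℕ) : WithTop ℕ∞) V (Icc a b)) (γ : Side)

include h hp hab hV

theorem trError_isBigO : (fun z : Σ x, Fin (d x).ne => (d z.1).trError V γ z.2) =O[⊤]
    fun z => (elems d z).size ^ (p + 1) :=
  (isRegularFamily_elems h).extrapolation_isBigO hp hab hV γ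

theorem flError_isBigO (hlam : ContDiffOn ℝ p lam (Icc a b)) :
    (fun z : Σ x, Fin (d x).ne => (d z.1).flError a b lam V γ z.2) =O[⊤]
      fun z => (elems d z).size ^ p := by
  refine (((isRegularFamily_elems h).fluxError_isBigO hp hab hlam hV γ).const_mul_left
    γ.normal).congr_left fun z => ?_
  have hDn : (d z.1).fl lam ((d z.1).restrict V) γ z.2 = _ :=
    SBPElement.Dn_dotProduct _ lam γ ((elems d z).restrict V)
  rw [flError, Pi.sub_apply, Pi.sub_apply, hDn]
  exact mul_sub _ _ _

theorem faceForm_error_isBigO (hlam : ContDiffOn ℝ p lam (Icc a b))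
    {s g : ∀ x, Side → Fin (d x).ne → ℝ} {ν : (Σ x, Fin (d x).ne) → ℝ}
    (hs : (fun z : Σ x, Fin (d x).ne => s z.1 γ z.2) =O[⊤] ν)
    (hg : (fun z : Σ x, Fin (d x).ne => (elems d z).size * g z.1 γ z.2) =O[⊤] ν) :
    (fun z : Σ x, Fin (d x).ne =>
      (d z.1).faceForm bc ((d z.1).trError V) ((d z.1).flError a b lam V) (s z.1) (g z.1) γ z.2)
      =O[⊤] fun z => ν z * (elems d z).size ^ p :=
  faceForm_isBigO h hp (t := fun x => (d x).trError V) (f := fun x => (d x).flError a b lam V)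
    (trError_isBigO h hp hab hV) (flError_isBigO h hp hab hV · hlam) γ hs hg

end ConsistencyErrors

section Sums

variable (h : ∀ x, (d x).IsAdmissible a b p bc lam C)

theorem IsAdmissible.sum_size_le {d : Discretization n} (hd : d.IsAdmissible a b p bc lam C) :
    ∑ k, (d.elem k).size ≤ C * (b - a) := by
  calc ∑ k, (d.elem k).size
      ≤ ∑ k, C * ((d.elem k).bdry Side.right - (d.elem k).bdry Side.left) :=
        Finset.sum_le_sum fun k _ => hd.scaled.size_le k
    _ = C * ∑ k, ∑ γ : Side, γ.normal * (d.elem k).bdry γ := by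
        simp only [Side.sum_normal_mul, Finset.mul_sum]
    _ = C * (b - a) := by
        rw [hd.tessellates.sum_normal_mul fun x => x, Side.sum_normal_mul]
        rfl

include h in
theorem sum_isBigO {e : ∀ x, Fin (d x).ne → ℝ} {ν : α → ℝ} {m : ℕ}
    (he : (fun z : Σ x, Fin (d x).ne => e z.1 z.2) =O[⊤]
      fun z => ν z.1 * (elems d z).size ^ (m + 1)) :
    (fun x => ∑ k, e x k) =O[⊤] fun x => ν x * (d x).h ^ m := by
  obtain ⟨c, hc, hbound⟩ := he.exists_pos
  rw [isBigOWith_top] at hbound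
  refine isBigO_top.mpr ⟨c * (C * (b - a)), fun x => ?_⟩
  have hterm (k : Fin (d x).ne) :
      ‖e x k‖ ≤ c * (‖ν x‖ * ‖(d x).h ^ m‖) * ((d x).elem k).size := by
    have hpow : ((d x).elem k).size ^ m ≤ ‖(d x).h ^ m‖ :=
      (pow_le_pow_left₀ ((d x).elem k).size_nonneg ((d x).size_le_h k) m).trans (le_abs_self _)
    calc ‖e x k‖ ≤ c * ‖ν x * ((d x).elem k).size ^ (m + 1)‖ := hbound ⟨x, k⟩
      _ = c * (‖ν x‖ * ((d x).elem k).size ^ m) * ((d x).elem k).size := by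
        rw [norm_mul, norm_pow, SBPElement.norm_size]
        ring
      _ ≤ _ := by
        gcongr
        exact SBPElement.size_nonneg _
  calc ‖∑ k, e x k‖ ≤ ∑ k, c * (‖ν x‖ * ‖(d x).h ^ m‖) * ((d x).elem k).size :=
        norm_sum_le_of_le _ fun k _ => hterm k
    _ = c * (‖ν x‖ * ‖(d x).h ^ m‖) * ∑ k, ((d x).elem k).size := (Finset.mul_sum _ _ _).symm
    _ ≤ c * (‖ν x‖ * ‖(d x).h ^ m‖) * (C * (b - a)) := by
        gcongr
        exact (h x).sum_size_le
    _ = c * (C * (b - a)) * ‖ν x * (d x).h ^ m‖ := by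
        rw [norm_mul]
        ring

end Sums

section FunctionalError

variable {F G U ψ : ℝ → ℝ} {uB ψB : Side → ℝ} (h : ∀ x, (d x).IsAdmissible a b p bc lam C)
  (hp : 1 ≤ p) (hab : a < b)

include h hp hab

theorem consistency_isBigO (hlam : ContDiffOn ℝ ((2 * p + 1 : ℕ) : WithTop ℕ∞) lam (Icc a b))
    (hU : ContDiffOn ℝ ((2 * p + 2 : ℕ) : WithTop ℕ∞) U (Icc a b))
    (hψ : ContDiffOn ℝ ((2 * p + 2 : ℕ) : WithTop ℕ∞) ψ (Icc a b)) {Φ : ℝ → ℝ}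
    (hΦ : ContDiffOn ℝ ((2 * p + 1 : ℕ) : WithTop ℕ∞) Φ (Icc a b)) :
    (fun x => ∑ k, (((d x).elem k).formDefect (.of a b lam) (.of a b U) (.of a b ψ) +
      ((d x).elem k).quadratureError a b (fun x => flux a b lam U x * ψ x) -
      ((d x).elem k).quadratureError a b Φ +
      ∑ γ : Side, (d x).faceForm bc ((d x).trError U) ((d x).flError a b lam U)
        ((d x).trError ψ) ((d x).flError a b lam ψ) γ k)) =O[⊤] fun x => (d x).h ^ (2 * p) := by
  have hE := isRegularFamily_elems h
  have hlow {V : ℝ → ℝ} (hV : ContDiffOn ℝ ((2 * p + 2 : ℕ) : WithTop ℕ∞) V (Icc a b)) :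
      ContDiffOn ℝ ((p + 1 : ℕ) : WithTop ℕ∞) V (Icc a b) := hV.of_le (by norm_cast; omega)
  have hlamp : ContDiffOn ℝ p lam (Icc a b) := hlam.of_le (by norm_cast; omega)
  have hfluxψ : ContDiffOn ℝ ((2 * p + 1 : ℕ) : WithTop ℕ∞) (fun x => flux a b lam U x * ψ x)
      (Icc a b) := (contDiffOn_flux hab hlam hU).mul (hψ.of_le (by norm_cast; omega))
  have hface (γ : Side) := faceForm_error_isBigO h hp hab (hlow hU) γ hlamp
    (s := fun x => (d x).trError ψ) (g := fun x => (d x).flError a b lam ψ)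
    (trError_isBigO h hp hab (hlow hψ) γ)
    (((isBigO_refl (fun z => (elems d z).size) ⊤).mul
      (flError_isBigO h hp hab (hlow hψ) γ hlamp)).congr_right fun z => (pow_succ' _ p).symm)
  have hlocal := (((hE.formDefect_isBigO hp hab hlam hU hψ).add
    (hE.quadratureError_isBigO hp hab hfluxψ)).sub (hE.quadratureError_isBigO hp hab hΦ)).add
    ((IsBigO.fun_sum fun γ (_ : γ ∈ Finset.univ) => hface γ).congr_right fun z => by
      rw [← pow_add, add_right_comm, ← two_mul])
  simpa using sum_isBigO h (ν := fun _ => 1) (hlocal.congr_right fun z => (one_mul _).symm)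

theorem residual_isBigO (hlam : ContDiffOn ℝ ((p + 1 : ℕ) : WithTop ℕ∞) lam (Icc a b))
    (hU : ContDiffOn ℝ ((p + 2 : ℕ) : WithTop ℕ∞) U (Icc a b))
    {ε : ∀ x, Fin (d x).ne → Fin n → ℝ} {ν : α → ℝ}
    (hε : ∀ i, (fun z : Σ x, Fin (d x).ne => ε z.1 z.2 i) =O[⊤] fun z => ν z.1) :
    (fun x => ∑ k, (((d x).elem k).weakResidual a b lam U (ε x k) +
      ∑ γ : Side, (d x).faceForm bc ((d x).trError U) ((d x).flError a b lam U)
        ((d x).tr (ε x)) ((d x).fl lam (ε x)) γ k)) =O[⊤]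
      fun x => ν x * (d x).h ^ (p - 1) := by
  have hE := isRegularFamily_elems h
  have hlow : ContDiffOn ℝ ((p + 1 : ℕ) : WithTop ℕ∞) U (Icc a b) :=
    hU.of_le (by norm_cast; omega)
  have hlamp : ContDiffOn ℝ p lam (Icc a b) := hlam.of_le (by norm_cast; omega)
  have hface (γ : Side) := faceForm_error_isBigO h hp hab hlow γ hlamp
    (s := fun x => (d x).tr (ε x)) (g := fun x => (d x).fl lam (ε x)) (hE.R_dotProduct_isBigO hε γ)
    (hE.size_mul_Dn_dotProduct_isBigO hlam.continuousOn hε γ)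
  refine sum_isBigO h (((hE.weakResidual_isBigO hp hab hlam hU hε).add
    (IsBigO.fun_sum fun γ (_ : γ ∈ Finset.univ) => hface γ)).congr_right fun z => ?_)
  rw [Nat.sub_add_cancel hp]

theorem functional_error_isBigO
    (hlam : ContDiffOn ℝ ((2 * p + 1 : ℕ) : WithTop ℕ∞) lam (Icc a b))
    (hUs : ContDiffOn ℝ ((2 * p + 2 : ℕ) : WithTop ℕ∞) U (Icc a b))
    (hψs : ContDiffOn ℝ ((2 * p + 2 : ℕ) : WithTop ℕ∞) ψ (Icc a b))
    (hU : SolvesDiffusion a b bc lam F U uB) (hψ : SolvesDiffusion a b bc lam G ψ ψB)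
    {uh ψh : ∀ x, Fin (d x).ne → Fin n → ℝ} {C' : ℝ}
    (huh : ∀ x, (d x).SolvesPrimal bc lam uB (uh x) F)
    (hψh : ∀ x, (d x).SolvesAdjoint bc lam ψB (ψh x) G)
    (hacc : ∀ x, (d x).Accurate (ψh x) ψ (p + 1) C') :
    (fun x => functional a b bc lam G ψB U - (d x).discreteFunctional bc lam uB (uh x) G ψB) =O[⊤]
      fun x => (d x).h ^ (2 * p) := by
  have hG : ContDiffOn ℝ ((2 * p : ℕ) : WithTop ℕ∞) G (Icc a b) :=
    hψ.contDiffOn_source hab hlam hψs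
  obtain ⟨Φ, hΦs, hΦ, hint⟩ := exists_primitive hab (hG.mul (hUs.of_le (by norm_cast; omega)))
  have herror (i : Fin n) : (fun z : Σ x, Fin (d x).ne =>
      ((d z.1).restrict ψ - ψh z.1) z.2 i) =O[⊤] fun z => (d z.1).h ^ (p + 1) :=
    isBigO_top.mpr ⟨C', fun z => by
      rw [Real.norm_of_nonneg (pow_nonneg (d z.1).h_nonneg _)]
      exact hacc z.1 z.2 i⟩
  have hresidual := residual_isBigO h hp hab (hlam.of_le (by norm_cast; omega))
    (hUs.of_le (by norm_cast; omega)) (ε := fun x => (d x).restrict ψ - ψh x)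
    (ν := fun x => (d x).h ^ (p + 1)) herror
  refine ((consistency_isBigO h hp hab hlam hUs hψs hΦs).sub
    (hresidual.congr_right fun x => ?_)).congr_left fun x => ?_
  · rw [← pow_add]
    congr 1
    omega
  · exact (functional_sub_discreteFunctional hab (hlam.of_le (by norm_cast; omega))
      (hUs.of_le (by norm_cast; omega)) (hψs.differentiableOn (by norm_cast)) (h x) hU hψ
      (huh x) (hψh x) hΦ hint).symm

end FunctionalError

end Families

end Discretization

section Superconvergence

open Asymptotics

variable {p : ℕ} {a b : ℝ} {bc : Side → BC} {lam F G U ψ : ℝ → ℝ} {uB ψB : Side → ℝ}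

theorem exists_functional_error_le (n : ℕ) (hp : 1 ≤ p) (hab : a < b)
    (hUs : ContDiffOn ℝ ((2 * p + 2 : ℕ) : WithTop ℕ∞) U (Icc a b))
    (hψs : ContDiffOn ℝ ((2 * p + 2 : ℕ) : WithTop ℕ∞) ψ (Icc a b))
    (hlam : ContDiffOn ℝ ((2 * p + 1 : ℕ) : WithTop ℕ∞) lam (Icc a b))
    (hU : SolvesDiffusion a b bc lam F U uB) (hψ : SolvesDiffusion a b bc lam G ψ ψB)
    (C C' : ℝ) : ∃ K : ℝ, ∀ d : Discretization n, d.IsAdmissible a b p bc lam C →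
      ∀ uh ψh : Fin d.ne → Fin n → ℝ, d.SolvesPrimal bc lam uB uh F →
        d.SolvesAdjoint bc lam ψB ψh G → d.Accurate ψh ψ (p + 1) C' →
        |functional a b bc lam G ψB U - d.discreteFunctional bc lam uB uh G ψB|
          ≤ K * d.h ^ (2 * p) := by
  let Instance := {y : Σ d : Discretization n, (Fin d.ne → Fin n → ℝ) × (Fin d.ne → Fin n → ℝ) //
    y.1.IsAdmissible a b p bc lam C ∧ y.1.SolvesPrimal bc lam uB y.2.1 F ∧
      y.1.SolvesAdjoint bc lam ψB y.2.2 G ∧ y.1.Accurate y.2.2 ψ (p + 1) C'}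
  obtain ⟨K, hK⟩ := isBigO_top.mp <| Discretization.functional_error_isBigO
    (d := fun y : Instance => y.1.1) (uh := fun y => y.1.2.1) (ψh := fun y => y.1.2.2)
    (fun y => y.2.1) hp hab hlam hUs hψs hU hψ (fun y => y.2.2.1) (fun y => y.2.2.2.1)
    fun y => y.2.2.2.2
  refine ⟨K, fun d hd uh ψh huh hψh hacc => ?_⟩
  have hbound := hK ⟨⟨d, uh, ψh⟩, hd, huh, hψh, hacc⟩
  rwa [Real.norm_of_nonneg (pow_nonneg d.h_nonneg _)] at hbound

/- The second estimate is the first one for the dual discretization, whose interface coefficients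
are shifted by `1`. -/
theorem theorem2_general (n : ℕ) (hp : 1 ≤ p) (hab : a < b)
    (hUs : ContDiffOn ℝ ((2 * p + 2 : ℕ) : WithTop ℕ∞) U (Icc a b))
    (hψs : ContDiffOn ℝ ((2 * p + 2 : ℕ) : WithTop ℕ∞) ψ (Icc a b))
    (hlam : ContDiffOn ℝ ((2 * p + 1 : ℕ) : WithTop ℕ∞) lam (Icc a b))
    (hU : SolvesDiffusion a b bc lam F U uB) (hψ : SolvesDiffusion a b bc lam G ψ ψB) :
    functional a b bc lam G ψB U = functional a b bc lam F uB ψ ∧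
    ∀ C C' : ℝ, ∃ K : ℝ, ∀ d : Discretization n, d.IsAdmissible a b p bc lam C →
      ∀ uh ψh : Fin d.ne → Fin n → ℝ, d.SolvesPrimal bc lam uB uh F →
        d.SolvesAdjoint bc lam ψB ψh G →
        (d.Accurate ψh ψ (p + 1) C' →
          |functional a b bc lam G ψB U - d.discreteFunctional bc lam uB uh G ψB|
            ≤ K * d.h ^ (2 * p)) ∧
        (d.Accurate uh U (p + 1) C' →
          |functional a b bc lam F uB ψ - d.discreteFunctional bc lam ψB ψh F uB|
            ≤ K * d.h ^ (2 * p)) := by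
  refine ⟨functional_eq hab (hlam.of_le (by norm_cast; omega)) (hUs.of_le (by norm_cast; omega))
    (hψs.of_le (by norm_cast; omega)) hU hψ, fun C C' => ?_⟩
  obtain ⟨K, hK⟩ := exists_functional_error_le n hp hab hUs hψs hlam hU hψ C C'
  obtain ⟨L, hL⟩ := exists_functional_error_le n hp hab hψs hUs hlam hψ hU (C + 1) C'
  refine ⟨max K L, fun d hd uh ψh huh hψh => ⟨fun hacc => ?_, fun hacc => ?_⟩⟩
  · exact (hK d hd uh ψh huh hψh hacc).trans
      (mul_le_mul_of_nonneg_right (le_max_left K L) (pow_nonneg d.h_nonneg _))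
  · have hψh' := hd.adjointConsistent.solvesPrimal_dual_iff.mpr hψh
    have huh' := hd.adjointConsistent.solvesAdjoint_dual_iff.mpr huh
    rw [← Discretization.dual_discreteFunctional hd.tessellates.ne_pos]
    exact (hL d.dual hd.dual ψh uh hψh' huh' hacc).trans
      (mul_le_mul_of_nonneg_right (le_max_right K L) (pow_nonneg d.h_nonneg _))

end Superconvergence

end

theorem theorem2 (p n : ℕ) (hp : 1 ≤ p) (a b : ℝ) (hab : a < b)
    (bc : Side → BC) (hbc : ∃ γ, bc γ = BC.dirichlet)
    (lam F G U ψ : ℝ → ℝ) (uB ψB : Side → ℝ)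
    (hUs : ContDiffOn ℝ ((2 * p + 2 : ℕ) : WithTop ℕ∞) U (Icc a b))
    (hψs : ContDiffOn ℝ ((2 * p + 2 : ℕ) : WithTop ℕ∞) ψ (Icc a b))
    (hlams : ContDiffOn ℝ ((2 * p + 1 : ℕ) : WithTop ℕ∞) lam (Icc a b))
    (hFs : ContDiffOn ℝ ((2 * p : ℕ) : WithTop ℕ∞) F (Icc a b))
    (hGs : ContDiffOn ℝ ((2 * p : ℕ) : WithTop ℕ∞) G (Icc a b))
    (hlam : ∀ x ∈ Icc a b, 0 < lam x)
    (hU : SolvesDiffusion a b bc lam F U uB)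
    (hψ : SolvesDiffusion a b bc lam G ψ ψB) :
    functional a b bc lam G ψB U = functional a b bc lam F uB ψ ∧
    ∀ C : ℝ, ∃ K : ℝ, ∀ d : Discretization n,
      d.Tessellates a b →
      (∀ k, (d.elem k).IsSBP p) →
      (∀ k, (d.elem k).IsNarrow p ∨ (d.elem k).IsWide) →
      d.Scaled bc C →
      d.AdjointConsistent lam →
      ∀ uh ψh : Fin d.ne → Fin n → ℝ,
        d.SolvesPrimal bc lam uB uh F →
        d.SolvesAdjoint bc lam ψB ψh G →
        d.Accurate uh U (p + 1) C →
        d.Accurate ψh ψ (p + 1) C →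
        |functional a b bc lam G ψB U - d.discreteFunctional bc lam uB uh G ψB|
            ≤ K * d.h ^ (2 * p) ∧
        |functional a b bc lam F uB ψ - d.discreteFunctional bc lam ψB ψh F uB|
            ≤ K * d.h ^ (2 * p) := by
  obtain ⟨heq, hest⟩ := theorem2_general n hp hab hUs hψs hlams hU hψ
  refine ⟨heq, fun C => (hest C C).imp fun K hK d hT hE hk hS hA uh ψh huh hψh hu hψ' => ?_⟩
  obtain ⟨hfirst, hsecond⟩ := hK d ⟨hT, hE, hk, hS, hA⟩ uh ψh huh hψh
  exact ⟨hfirst hψ', hsecond hu⟩
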